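/- Let $\mathcal X_1,\mathcal X_2,\mathcal X_3,\mathcal Y$ be finite alphabets and let $p(y|x_1,x_2,x_3)$ be the transition probability of a discrete memoryless channel. Two transmitters and a relay send independent, uniformly distributed messages $W_i\in\mathcal W_i=\{1,\dots,2^{nR_i}\}$ ($i=1,2,3$; $2^{nR_i}$ rounded up to an integer, $R_i\ge 0$) to one receiver, and the relay, whose own message is $W_3$, also knows $W_1$ (but not $W_2$) in advance. Thus a $(2^{nR_1},2^{nR_2},2^{nR_3},n)$ code consists of encoders $f_1:\mathcal W_1\to\mathcal X_1^n$, $f_2:\mathcal W_2\to\mathcal X_2^n$, $f_3:\mathcal W_1\times\mathcal W_3\to\mathcal X_3^n$ and a decoder $h:\mathcal Y^n\to\mathcal W_1\times\mathcal W_2\times\mathcal W_3$. A triple $(R_1,R_2,R_3)$ of non-negative rates is achievable if there is a sequence of such codes, $n=1,2,\dots$, whose average probability $\Pr[h(Y^n)\ne(W_1,W_2,W_3)]$ of block error tends to $0$; the capacity region is the closure of the set of achievable triples. Then the capacity region is the closure of the set of all non-negative $(R_1,R_2,R_3)$ such that \begin{align*} R_2&\le I(X_2;Y|X_1,X_3,Q),\\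 R_3&\le I(X_3;Y|X_1,X_2,Q),\\ R_1+R_3&\le I(X_1,X_3;Y|X_2,Q),\\ R_2+R_3&\le I(X_2,X_3;Y|X_1,Q),\\ R_1+R_2+R_3&\le I(X_1,X_2,X_3;Y|Q) \end{align*} for some joint distribution of $(Q,X_1,X_2,X_3,Y)$ of the form $p(q)\,p(x_2|q)\,p(x_1,x_3|q)\,p(y|x_1,x_2,x_3)$, with $Q$ taking values in some finite set. Mutual information is measured in bits (logarithms to base $2$). -/

import Mathlib

namespace CogRelayMAC

/-- The law of the random variable `X` on the finite probability space `Ω` with mass function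
`P`: `law P X x = Pr[X = x]`. -/
noncomputable def law {Ω α : Type*} [Fintype Ω] (P : Ω → ℝ) (X : Ω → α) (x : α) : ℝ :=
  open Classical in ∑ ω, if X ω = x then P ω else 0

/-- Conditional mutual information `I(X;Y|Z)` in bits of random variables with finitely many
values on the finite probability space `Ω` with mass function `P`,
`∑ p(x,y,z) log₂ (p(x,y,z) p(z) / (p(x,z) p(y,z)))`.
Terms with `p(x,y,z) = 0` vanish, and if `p(x,y,z) > 0` then the ratio is positive. -/
noncomputable def condMutualInfo {Ω α β γ : Type*} [Fintype Ω] [Fintype α] [Fintype β]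
    [Fintype γ] (P : Ω → ℝ) (X : Ω → α) (Y : Ω → β) (Z : Ω → γ) : ℝ :=
  ∑ x, ∑ y, ∑ z, law P (fun ω => (X ω, Y ω, Z ω)) (x, y, z) *
    Real.logb 2 (law P (fun ω => (X ω, Y ω, Z ω)) (x, y, z) * law P Z z /
      (law P (fun ω => (X ω, Z ω)) (x, z) * law P (fun ω => (Y ω, Z ω)) (y, z)))

/-- A block code of length `n` with `M₁`, `M₂`, `M₃` messages: transmitter 1 knows `w₁`,
transmitter 2 knows `w₂`, the relay knows its own message `w₃` and also `w₁` (not `w₂`), and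
the receiver estimates all three messages from the channel output. -/
structure Code (X₁ X₂ X₃ Y : Type*) (M₁ M₂ M₃ n : ℕ) where
  /-- encoder of transmitter 1 -/
  f₁ : Fin M₁ → Fin n → X₁
  /-- encoder of transmitter 2 -/
  f₂ : Fin M₂ → Fin n → X₂
  /-- encoder of the relay -/
  f₃ : Fin M₁ → Fin M₃ → Fin n → X₃
  /-- decoder -/
  h : (Fin n → Y) → Fin M₁ × Fin M₂ × Fin M₃

section

variable {X₁ X₂ X₃ Y : Type*} [Fintype Y]

/-- Probability that the decoder errs when the messages are `w₁, w₂, w₃`, over the memoryless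
channel with transition probabilities `W x₁ x₂ x₃ y = p(y|x₁,x₂,x₃)`. -/
noncomputable def Code.errorProb {M₁ M₂ M₃ n : ℕ} (c : Code X₁ X₂ X₃ Y M₁ M₂ M₃ n)
    (W : X₁ → X₂ → X₃ → Y → ℝ) (w₁ : Fin M₁) (w₂ : Fin M₂) (w₃ : Fin M₃) : ℝ :=
  ∑ y : Fin n → Y, if c.h y ≠ (w₁, w₂, w₃) then
    ∏ i, W (c.f₁ w₁ i) (c.f₂ w₂ i) (c.f₃ w₁ w₃ i) (y i) else 0

/-- Average probability of block error, for uniformly distributed independent messages. -/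
noncomputable def Code.avgErrorProb {M₁ M₂ M₃ n : ℕ} (c : Code X₁ X₂ X₃ Y M₁ M₂ M₃ n)
    (W : X₁ → X₂ → X₃ → Y → ℝ) : ℝ :=
  (∑ w₁, ∑ w₂, ∑ w₃, c.errorProb W w₁ w₂ w₃) / ((M₁ : ℝ) * M₂ * M₃)

end

/-- The number of messages at rate `R` and block length `n`, that is `2^(nR)` rounded up to an
integer. -/
noncomputable def numMessages (R : ℝ) (n : ℕ) : ℕ := ⌈(2 : ℝ) ^ ((n : ℝ) * R)⌉₊

/-- A triple of (non-negative) rates is achievable if some sequence of codes with these rates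
has vanishing average error probability. -/
def Achievable {X₁ X₂ X₃ Y : Type*} [Fintype Y] (W : X₁ → X₂ → X₃ → Y → ℝ)
    (R₁ R₂ R₃ : ℝ) : Prop :=
  0 ≤ R₁ ∧ 0 ≤ R₂ ∧ 0 ≤ R₃ ∧
    ∃ c : ∀ n : ℕ, Code X₁ X₂ X₃ Y (numMessages R₁ n) (numMessages R₂ n) (numMessages R₃ n) n,
      Filter.Tendsto (fun n => (c n).avgErrorProb W) Filter.atTop (nhds 0)

/-- The capacity region: the closure of the set of achievable rate triples. -/
def capacityRegion {X₁ X₂ X₃ Y : Type*} [Fintype Y] (W : X₁ → X₂ → X₃ → Y → ℝ) :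
    Set (ℝ × ℝ × ℝ) :=
  closure {R | Achievable W R.1 R.2.1 R.2.2}

/-- The joint mass function `p(q) p(x₂|q) p(x₁,x₃|q) p(y|x₁,x₂,x₃)` of `(Q, X₁, X₂, X₃, Y)`. -/
def jointPmf {A X₁ X₂ X₃ Y : Type*} (pQ : A → ℝ) (p₂ : A → X₂ → ℝ) (p₁₃ : A → X₁ × X₃ → ℝ)
    (W : X₁ → X₂ → X₃ → Y → ℝ) : A × X₁ × X₂ × X₃ × Y → ℝ :=
  fun (q, x₁, x₂, x₃, y) => pQ q * p₂ q x₂ * p₁₃ q (x₁, x₃) * W x₁ x₂ x₃ y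

/-- The rate triples satisfying all the mutual information bounds for a joint mass function `P`
of `(Q, X₁, X₂, X₃, Y)`. -/
structure RateBounds {A X₁ X₂ X₃ Y : Type*} [Fintype A] [Fintype X₁] [Fintype X₂] [Fintype X₃]
    [Fintype Y] (P : A × X₁ × X₂ × X₃ × Y → ℝ) (R₁ R₂ R₃ : ℝ) : Prop where
  /-- `R₂ ≤ I(X₂; Y | X₁, X₃, Q)` -/
  bound₂ : R₂ ≤ condMutualInfo P (fun (_, _, x₂, _, _) => x₂) (fun (_, _, _, _, y) => y)
    (fun (q, x₁, _, x₃, _) => (x₁, x₃, q))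
  /-- `R₃ ≤ I(X₃; Y | X₁, X₂, Q)` -/
  bound₃ : R₃ ≤ condMutualInfo P (fun (_, _, _, x₃, _) => x₃) (fun (_, _, _, _, y) => y)
    (fun (q, x₁, x₂, _, _) => (x₁, x₂, q))
  /-- `R₁ + R₃ ≤ I(X₁, X₃; Y | X₂, Q)` -/
  bound₁₃ : R₁ + R₃ ≤ condMutualInfo P (fun (_, x₁, _, x₃, _) => (x₁, x₃))
    (fun (_, _, _, _, y) => y) (fun (q, _, x₂, _, _) => (x₂, q))
  /-- `R₂ + R₃ ≤ I(X₂, X₃; Y | X₁, Q)` -/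
  bound₂₃ : R₂ + R₃ ≤ condMutualInfo P (fun (_, _, x₂, x₃, _) => (x₂, x₃))
    (fun (_, _, _, _, y) => y) (fun (q, x₁, _, _, _) => (x₁, q))
  /-- `R₁ + R₂ + R₃ ≤ I(X₁, X₂, X₃; Y | Q)` -/
  bound₁₂₃ : R₁ + R₂ + R₃ ≤ condMutualInfo P (fun (_, x₁, x₂, x₃, _) => (x₁, x₂, x₃))
    (fun (_, _, _, _, y) => y) (fun (q, _, _, _, _) => q)

end CogRelayMAC

namespace CogRelayMAC

/-! Converse. Given a code of length `n`, let `Q` be a uniform time index and let the inputs be the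
code symbols at that time under uniform messages. Encoder 2 sees only `w₂` and the other two only
`(w₁, w₃)`, so the input law factors as required (`Code.sum_inputPmf_mul`). A Fano-type inequality
(`fano_le_inputInfo`), applied once per bound with the conditioning messages held fixed, puts the
rates shrunk by the success probability and by `1 / n`, and clipped at `0`, into the region
(`Code.mem_rateRegion`). As `n` grows they tend to the original rates.

Achievability. Superposition coding: each `w₁` has a cloud centre `x₁`, each `(w₁, w₃)` a satellite
`x₃` drawn around it, and `x₂` is drawn independently, all along a fixed time-sharing sequence. The
decoder accepts a message if five likelihood ratios exceed thresholds `2 ^ (n T s)`. Wrong messages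
fall into five classes. A wrong `w₁` always comes with a fresh `x₃`, whether or not `w₃` is right;
this is why neither `R₁` nor `R₁ + R₂` has a bound of its own. By a change of measure
(`collision_le`) a wrong message of class `s` is accepted with probability at most `2 ^ (-n T s)`,
so a union bound suffices when the rates lie below the thresholds. The mean log-likelihood ratios
are the mutual informations, so when the thresholds lie below them the true message is rejected with
exponentially small probability (`exists_threshold_bound`). Shrinking the rates slightly makes the
inequalities strict, and taking closures finishes. -/

/-! ### Sums against product measures and the averaging argument. -/

theorem sum_pi_prod {ι α : Type*} [Fintype ι] [DecidableEq ι] [Fintype α] (g : ι → α → ℝ) :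
    ∑ f : ι → α, ∏ k, g k (f k) = ∏ k, ∑ a, g k a := by
  classical
  rw [Finset.prod_univ_sum, Fintype.piFinset_univ]

theorem sum_pi_prod_mul_apply {ι α : Type*} [Fintype ι] [DecidableEq ι] [Fintype α]
    {μ : ι → α → ℝ} (hμ : ∀ i, ∑ a, μ i a = 1) (i : ι) (F : α → ℝ) :
    ∑ f : ι → α, (∏ k, μ k (f k)) * F (f i) = ∑ a, μ i a * F a := by
  have h : ∀ f : ι → α, (∏ k, μ k (f k)) * F (f i)
      = ∏ k, (μ k (f k) * if k = i then F (f k) else 1) := by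
    intro f
    rw [Finset.prod_mul_distrib, Finset.prod_ite_eq' Finset.univ i]
    simp
  simp_rw [h]
  rw [sum_pi_prod (fun k a => μ k a * if k = i then F a else 1), Fintype.prod_eq_single i]
  · simp
  · intro k hk
    simp [hk, hμ]

theorem sum_prod_mul_apply {ι α : Type*} [Fintype ι] [DecidableEq ι] [Fintype α] {μ : α → ℝ}
    (hμ : ∑ a, μ a = 1) (i : ι) (F : α → ℝ) :
    ∑ f : ι → α, (∏ k, μ (f k)) * F (f i) = ∑ a, μ a * F a :=
  sum_pi_prod_mul_apply (fun _ => hμ) i F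

theorem sum_prod_mul_apply_apply {ι α : Type*} [Fintype ι] [DecidableEq ι] [Fintype α] {μ : α → ℝ}
    (hμ : ∑ a, μ a = 1) {i j : ι} (hij : i ≠ j) (F : α → α → ℝ) :
    ∑ f : ι → α, (∏ k, μ (f k)) * F (f i) (f j) = ∑ a, ∑ b, μ a * μ b * F a b := by
  classical
  -- `F` does not factor in its two arguments; summing over the value `a` of `f i` with an indicator
  -- makes each summand a product over coordinates.
  have h : ∀ f : ι → α, (∏ k, μ (f k)) * F (f i) (f j)
      = ∑ a, ∏ k, (μ (f k) * if k = i then (if f k = a then 1 else 0) else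
        if k = j then F a (f k) else 1) := by
    intro f
    have h1 : ∀ a, ∏ k, (μ (f k) * if k = i then (if f k = a then 1 else 0) else
        if k = j then F a (f k) else 1)
        = (∏ k, μ (f k)) * ((if f i = a then 1 else 0) * F a (f j)) := by
      intro a
      rw [Finset.prod_mul_distrib]
      congr 1
      rw [Fintype.prod_eq_mul i j hij]
      · simp [hij.symm]
      · rintro k ⟨h1, h2⟩
        simp [h1, h2]
    simp_rw [h1, ← Finset.mul_sum]
    simp
  simp_rw [h]
  rw [Finset.sum_comm]
  refine Finset.sum_congr rfl fun a _ => ?_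
  rw [sum_pi_prod (fun k b => μ b * if k = i then (if b = a then 1 else 0) else
        if k = j then F a b else 1), Fintype.prod_eq_mul i j hij]
  · simp [hij.symm, Finset.mul_sum, mul_assoc]
  · rintro k ⟨h1, h2⟩
    simp [h1, h2, hμ]

theorem sum_prod_eq_one {ι α : Type*} [Fintype ι] [DecidableEq ι] [Fintype α] {μ : ι → α → ℝ}
    (hμ : ∀ i, ∑ a, μ i a = 1) : ∑ f : ι → α, ∏ k, μ k (f k) = 1 := by
  rw [sum_pi_prod]
  simp [hμ]

/-- Derandomization: it fixes first the time-sharing sequence and then the codebook. -/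
theorem exists_le_of_sum_le {Ω : Type*} [Fintype Ω] {P : Ω → ℝ} (hP : P ∈ stdSimplex ℝ Ω)
    {F : Ω → ℝ} {B : ℝ} (h : ∑ ω, P ω * F ω ≤ B) : ∃ ω, F ω ≤ B := by
  by_contra! hc
  have h0 : ∃ ω, 0 < P ω := by
    by_contra! h0
    have := Finset.sum_nonpos (s := Finset.univ) fun ω _ => h0 ω
    linarith [hP.2]
  obtain ⟨ω₀, h0⟩ := h0
  have : ∑ ω, P ω * B < ∑ ω, P ω * F ω :=
    Finset.sum_lt_sum (fun ω _ => mul_le_mul_of_nonneg_left (hc ω).le (hP.1 ω))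
      ⟨ω₀, Finset.mem_univ _, mul_lt_mul_of_pos_left (hc ω₀) h0⟩
  rw [← Finset.sum_mul, hP.2, one_mul] at this
  linarith

theorem sum_fin_ite_eq {M : ℕ} (i : Fin M) (a b : ℝ) :
    ∑ j : Fin M, (if j = i then a else b) = a + ((M : ℝ) - 1) * b := by
  have h : ∀ j : Fin M, (if j = i then a else b) = b + if j = i then a - b else 0 := by
    intro j; split_ifs <;> ring
  simp_rw [h, Finset.sum_add_distrib]
  simp
  ring

/-! ### Marginals of a random superposition codebook. -/

/-- The weight of a cloud in a superposition codebook: a cloud centre `x₁` and satellites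
`x₃` drawn independently from `p₃ x₁`. -/
def cloudWeight {X₁ X₃ κ : Type*} [Fintype κ] (p₁ : X₁ → ℝ) (p₃ : X₁ → X₃ → ℝ)
    (c : X₁ × (κ → X₃)) : ℝ :=
  p₁ c.1 * ∏ k, p₃ c.1 (c.2 k)

section

variable {X₁ X₃ κ ι : Type*} [Fintype κ] [DecidableEq κ] [Fintype ι] [DecidableEq ι]
  [Fintype X₁] [Fintype X₃] {p₁ : X₁ → ℝ} {p₃ : X₁ → X₃ → ℝ}

theorem cloudWeight_mem (h₁ : p₁ ∈ stdSimplex ℝ X₁) (h₃ : ∀ x₁, p₃ x₁ ∈ stdSimplex ℝ X₃) :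
    (cloudWeight p₁ p₃ : X₁ × (κ → X₃) → ℝ) ∈ stdSimplex ℝ (X₁ × (κ → X₃)) := by
  refine ⟨fun c => mul_nonneg (h₁.1 _) (Finset.prod_nonneg fun k _ => (h₃ _).1 _), ?_⟩
  simp only [Fintype.sum_prod_type, cloudWeight, ← Finset.mul_sum]
  simp_rw [sum_prod_eq_one (μ := fun (_ : κ) a => p₃ _ a) fun _ => (h₃ _).2, mul_one]
  exact h₁.2

theorem sum_cloudWeight_mul (h₃ : ∀ x₁, p₃ x₁ ∈ stdSimplex ℝ X₃) (k : κ) (F : X₁ → X₃ → ℝ) :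
    ∑ c, cloudWeight p₁ p₃ c * F c.1 (c.2 k)
      = ∑ a : X₁ × X₃, p₁ a.1 * p₃ a.1 a.2 * F a.1 a.2 := by
  simp only [Fintype.sum_prod_type, cloudWeight, mul_assoc, ← Finset.mul_sum]
  refine Finset.sum_congr rfl fun x₁ _ => ?_
  rw [sum_prod_mul_apply (h₃ x₁).2 k (F x₁)]

theorem sum_book_same (h₁ : p₁ ∈ stdSimplex ℝ X₁) (h₃ : ∀ x₁, p₃ x₁ ∈ stdSimplex ℝ X₃)
    (i : ι) (k : κ) (F : X₁ → X₃ → ℝ) :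
    ∑ c : ι → X₁ × (κ → X₃), (∏ i, cloudWeight p₁ p₃ (c i)) * F (c i).1 ((c i).2 k)
      = ∑ a : X₁ × X₃, p₁ a.1 * p₃ a.1 a.2 * F a.1 a.2 := by
  rw [sum_prod_mul_apply (cloudWeight_mem h₁ h₃).2 i (fun c => F c.1 (c.2 k)),
    sum_cloudWeight_mul h₃]

theorem sum_book_satellites (h₁ : p₁ ∈ stdSimplex ℝ X₁) (h₃ : ∀ x₁, p₃ x₁ ∈ stdSimplex ℝ X₃)
    (i : ι) {k k' : κ} (hk : k ≠ k') (F : X₁ → X₃ → X₃ → ℝ) :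
    ∑ c : ι → X₁ × (κ → X₃),
        (∏ i, cloudWeight p₁ p₃ (c i)) * F (c i).1 ((c i).2 k) ((c i).2 k')
      = ∑ x₁, ∑ a, ∑ b, p₁ x₁ * (p₃ x₁ a * p₃ x₁ b * F x₁ a b) := by
  rw [sum_prod_mul_apply (cloudWeight_mem h₁ h₃).2 i (fun c => F c.1 (c.2 k) (c.2 k'))]
  simp only [Fintype.sum_prod_type, cloudWeight, mul_assoc, ← Finset.mul_sum]
  refine Finset.sum_congr rfl fun x₁ _ => ?_
  rw [sum_prod_mul_apply_apply (h₃ x₁).2 hk (F x₁)]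
  simp only [mul_assoc, ← Finset.mul_sum]

theorem sum_book_clouds (h₁ : p₁ ∈ stdSimplex ℝ X₁) (h₃ : ∀ x₁, p₃ x₁ ∈ stdSimplex ℝ X₃)
    {i i' : ι} (hi : i ≠ i') (k k' : κ) (F : X₁ → X₃ → X₁ → X₃ → ℝ) :
    ∑ c : ι → X₁ × (κ → X₃),
        (∏ i, cloudWeight p₁ p₃ (c i)) * F (c i).1 ((c i).2 k) (c i').1 ((c i').2 k')
      = ∑ a : X₁ × X₃, ∑ b : X₁ × X₃,
        (p₁ a.1 * p₃ a.1 a.2) * (p₁ b.1 * p₃ b.1 b.2) * F a.1 a.2 b.1 b.2 := by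
  rw [sum_prod_mul_apply_apply (cloudWeight_mem h₁ h₃).2 hi
    (fun c c' => F c.1 (c.2 k) c'.1 (c'.2 k'))]
  have h : ∀ x₁ x₃, ∑ c', cloudWeight p₁ p₃ c' * F x₁ x₃ c'.1 (c'.2 k')
      = ∑ b : X₁ × X₃, p₁ b.1 * p₃ b.1 b.2 * F x₁ x₃ b.1 b.2 :=
    fun x₁ x₃ => sum_cloudWeight_mul h₃ k' (F x₁ x₃)
  have h' := sum_cloudWeight_mul (p₁ := p₁) h₃ k (fun x₁ x₃ =>
    ∑ c' : X₁ × (κ → X₃), cloudWeight p₁ p₃ c' * F x₁ x₃ c'.1 (c'.2 k'))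
  simp_rw [h] at h'
  simp_rw [mul_assoc] at h' ⊢
  simp_rw [← Finset.mul_sum]
  rw [← h']
  refine Finset.sum_congr rfl fun c _ => ?_
  have h2 := h c.1 (c.2 k)
  simp_rw [mul_assoc] at h2
  rw [h2]

end

/-! ### Probability that a wrong codeword passes the threshold test. -/

open Classical in
/-- If an independent copy `b` of the channel input `a` (given the common part `c`) satisfies
`G` only when the likelihood of the output under `b` exceeds its mean by the factor `1 / ε`, then
`b` satisfies `G` with probability at most `ε`. -/
theorem collision_le {C A Y : Type*} [Fintype C] [Fintype A] [Fintype Y] {r : C → ℝ}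
    {s : C → A → ℝ} {V : C → A → Y → ℝ} {G : C → A → Y → Prop} {ε : ℝ} (hε : 0 ≤ ε)
    (hr : r ∈ stdSimplex ℝ C) (hs : ∀ c, s c ∈ stdSimplex ℝ A)
    (hV : ∀ c a, V c a ∈ stdSimplex ℝ Y)
    (hG : ∀ c b y, G c b y → ∑ a, s c a * V c a y ≤ ε * V c b y) :
    ∑ c, r c * ∑ a, ∑ b, s c a * s c b * ∑ y, V c a y * (if G c b y then 1 else 0) ≤ ε := by
  have key : ∀ c, ∑ a, ∑ b, s c a * s c b * ∑ y, V c a y * (if G c b y then 1 else 0) ≤ ε := by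
    intro c
    -- Change of measure: averaging over the true input `a` first leaves the mean likelihood, which
    -- `G` bounds by `ε` times the likelihood under `b`; the latter sums to one over `y`.
    calc ∑ a, ∑ b, s c a * s c b * ∑ y, V c a y * (if G c b y then 1 else 0)
        = ∑ b, s c b * ∑ y, (if G c b y then 1 else 0) * ∑ a, s c a * V c a y := by
          rw [Finset.sum_comm]
          refine Finset.sum_congr rfl fun b _ => ?_
          simp_rw [Finset.mul_sum]
          rw [Finset.sum_comm]
          refine Finset.sum_congr rfl fun y _ => Finset.sum_congr rfl fun a _ => ?_
          ring
      _ ≤ ∑ b, s c b * ∑ y, ε * V c b y := by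
          refine Finset.sum_le_sum fun b _ => mul_le_mul_of_nonneg_left ?_ ((hs c).1 b)
          refine Finset.sum_le_sum fun y _ => ?_
          split_ifs with h
          · rw [one_mul]; exact hG c b y h
          · rw [zero_mul]; exact mul_nonneg hε ((hV c b).1 y)
      _ = ε := by
          simp_rw [← Finset.mul_sum, (hV c _).2, mul_one, ← Finset.sum_mul, (hs c).2, one_mul]
  calc _ ≤ ∑ c, r c * ε := Finset.sum_le_sum fun c _ => mul_le_mul_of_nonneg_left (key c) (hr.1 c)
    _ = ε := by rw [← Finset.sum_mul, hr.2, one_mul]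

theorem mul_mem_stdSimplex {A B : Type*} [Fintype A] [Fintype B] {p : A → ℝ} {s : A → B → ℝ}
    (hp : p ∈ stdSimplex ℝ A) (hs : ∀ a, s a ∈ stdSimplex ℝ B) :
    (fun c : A × B => p c.1 * s c.1 c.2) ∈ stdSimplex ℝ (A × B) := by
  refine ⟨fun c => mul_nonneg (hp.1 _) ((hs _).1 _), ?_⟩
  simp only [Fintype.sum_prod_type, ← Finset.mul_sum, (hs _).2, mul_one]
  exact hp.2

section

variable {X₁ X₂ X₃ Y : Type*} [Fintype X₁] [Fintype X₂] [Fintype X₃] [Fintype Y]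
  {p₁ : X₁ → ℝ} {p₂ : X₂ → ℝ} {p₃ : X₁ → X₃ → ℝ} {W : X₁ → X₂ → X₃ → Y → ℝ} {M₁ M₂ M₃ : ℕ}
  {G : X₁ → X₂ → X₃ → Y → Prop}

open Classical in
/-- The probability, over a random superposition codebook and the channel output for the messages
`w`, that the codeword of `w'` and the output satisfy `G`. -/
noncomputable def pairProb (p₁ : X₁ → ℝ) (p₂ : X₂ → ℝ) (p₃ : X₁ → X₃ → ℝ)
    (W : X₁ → X₂ → X₃ → Y → ℝ) (G : X₁ → X₂ → X₃ → Y → Prop)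
    (w w' : Fin M₁ × Fin M₂ × Fin M₃) : ℝ :=
  ∑ c₂ : Fin M₂ → X₂, (∏ k, p₂ (c₂ k)) * ∑ c : Fin M₁ → X₁ × (Fin M₃ → X₃),
    (∏ k, cloudWeight p₁ p₃ (c k)) *
      ∑ y, W (c w.1).1 (c₂ w.2.1) ((c w.1).2 w.2.2) y *
        (if G (c w'.1).1 (c₂ w'.2.1) ((c w'.1).2 w'.2.2) y then 1 else 0)

open Classical in
theorem pairProb_self (h₁ : p₁ ∈ stdSimplex ℝ X₁) (h₂ : p₂ ∈ stdSimplex ℝ X₂)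
    (h₃ : ∀ x₁, p₃ x₁ ∈ stdSimplex ℝ X₃) (w : Fin M₁ × Fin M₂ × Fin M₃) :
    pairProb p₁ p₂ p₃ W G w w = ∑ x₂, p₂ x₂ * ∑ a : X₁ × X₃, p₁ a.1 * p₃ a.1 a.2 *
      ∑ y, W a.1 x₂ a.2 y * (if G a.1 x₂ a.2 y then 1 else 0) := by
  unfold pairProb
  rw [← sum_prod_mul_apply h₂.2 w.2.1]
  refine Finset.sum_congr rfl fun c₂ _ => ?_
  rw [sum_book_same h₁ h₃ w.1 w.2.2 (fun x₁ x₃ => ∑ y, W x₁ (c₂ w.2.1) x₃ y *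
    (if G x₁ (c₂ w.2.1) x₃ y then 1 else 0))]

/-- In this and the next four lemmas, `C` in `collision_le` holds the symbols shared by the two
codewords and `A` those drawn independently for the wrong one. Here `(x₁, x₃)` is shared and `x₂` is
fresh. -/
theorem pairProb_le₂ (h₁ : p₁ ∈ stdSimplex ℝ X₁) (h₂ : p₂ ∈ stdSimplex ℝ X₂)
    (h₃ : ∀ x₁, p₃ x₁ ∈ stdSimplex ℝ X₃) (hW : ∀ x₁ x₂ x₃, W x₁ x₂ x₃ ∈ stdSimplex ℝ Y)
    {ε : ℝ} (hε : 0 ≤ ε)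
    (hG : ∀ x₁ x₂ x₃ y, G x₁ x₂ x₃ y → ∑ a, p₂ a * W x₁ a x₃ y ≤ ε * W x₁ x₂ x₃ y)
    (i : Fin M₁) {j j' : Fin M₂} (k : Fin M₃) (hj : j ≠ j') :
    pairProb p₁ p₂ p₃ W G (i, j, k) (i, j', k) ≤ ε := by
  classical
  refine le_trans (le_of_eq ?_) (collision_le (V := fun (c : X₁ × X₃) a => W c.1 a c.2)
    (G := fun c b y => G c.1 b c.2 y) hε (mul_mem_stdSimplex h₁ h₃) (fun _ => h₂)
    (fun c a => hW _ _ _) (fun c b y h => hG c.1 b c.2 y h))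
  unfold pairProb
  have h := fun c₂ : Fin M₂ → X₂ => sum_book_same h₁ h₃ i k
    (fun x₁ x₃ => ∑ y, W x₁ (c₂ j) x₃ y * (if G x₁ (c₂ j') x₃ y then 1 else 0))
  simp_rw [h, Finset.mul_sum (s := (Finset.univ : Finset (X₁ × X₃)))]
  rw [Finset.sum_comm]
  refine Finset.sum_congr rfl fun c _ => ?_
  rw [← sum_prod_mul_apply_apply h₂.2 hj, Finset.mul_sum]
  exact Finset.sum_congr rfl fun _ _ => mul_left_comm _ _ _

theorem pairProb_le₃ (h₁ : p₁ ∈ stdSimplex ℝ X₁) (h₂ : p₂ ∈ stdSimplex ℝ X₂)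
    (h₃ : ∀ x₁, p₃ x₁ ∈ stdSimplex ℝ X₃) (hW : ∀ x₁ x₂ x₃, W x₁ x₂ x₃ ∈ stdSimplex ℝ Y)
    {ε : ℝ} (hε : 0 ≤ ε)
    (hG : ∀ x₁ x₂ x₃ y, G x₁ x₂ x₃ y → ∑ a, p₃ x₁ a * W x₁ x₂ a y ≤ ε * W x₁ x₂ x₃ y)
    (i : Fin M₁) (j : Fin M₂) {k k' : Fin M₃} (hk : k ≠ k') :
    pairProb p₁ p₂ p₃ W G (i, j, k) (i, j, k') ≤ ε := by
  classical
  refine le_trans (le_of_eq ?_) (collision_le (V := fun (c : X₂ × X₁) a => W c.2 c.1 a)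
    (s := fun c => p₃ c.2)
    (G := fun c b y => G c.2 c.1 b y) hε (mul_mem_stdSimplex h₂ fun _ => h₁) (fun _ => h₃ _)
    (fun c a => hW _ _ _) (fun c b y h => hG c.2 c.1 b y h))
  unfold pairProb
  have h := fun c₂ : Fin M₂ → X₂ => sum_book_satellites h₁ h₃ i hk
    (fun x₁ a b => ∑ y, W x₁ (c₂ j) a y * (if G x₁ (c₂ j) b y then 1 else 0))
  simp_rw [h]
  rw [sum_prod_mul_apply h₂.2 j (fun x₂ => ∑ x₁, ∑ a, ∑ b, p₁ x₁ * (p₃ x₁ a * p₃ x₁ b *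
    ∑ y, W x₁ x₂ a y * (if G x₁ x₂ b y then 1 else 0)))]
  simp_rw [Fintype.sum_prod_type, ← Finset.mul_sum, mul_assoc, Finset.mul_sum]

theorem pairProb_le₂₃ (h₁ : p₁ ∈ stdSimplex ℝ X₁) (h₂ : p₂ ∈ stdSimplex ℝ X₂)
    (h₃ : ∀ x₁, p₃ x₁ ∈ stdSimplex ℝ X₃) (hW : ∀ x₁ x₂ x₃, W x₁ x₂ x₃ ∈ stdSimplex ℝ Y)
    {ε : ℝ} (hε : 0 ≤ ε)
    (hG : ∀ x₁ x₂ x₃ y, G x₁ x₂ x₃ y →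
      ∑ a : X₂ × X₃, p₂ a.1 * p₃ x₁ a.2 * W x₁ a.1 a.2 y ≤ ε * W x₁ x₂ x₃ y)
    (i : Fin M₁) {j j' : Fin M₂} {k k' : Fin M₃} (hj : j ≠ j') (hk : k ≠ k') :
    pairProb p₁ p₂ p₃ W G (i, j, k) (i, j', k') ≤ ε := by
  classical
  refine le_trans (le_of_eq ?_) (collision_le (V := fun x₁ (a : X₂ × X₃) => W x₁ a.1 a.2)
    (G := fun x₁ b y => G x₁ b.1 b.2 y) hε h₁ (fun x₁ => mul_mem_stdSimplex h₂ fun _ => h₃ x₁)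
    (fun c a => hW _ _ _) (fun x₁ b y h => hG x₁ b.1 b.2 y h))
  unfold pairProb
  have h := fun c₂ : Fin M₂ → X₂ => sum_book_satellites h₁ h₃ i hk
    (fun x₁ a b => ∑ y, W x₁ (c₂ j) a y * (if G x₁ (c₂ j') b y then 1 else 0))
  simp_rw [h]
  rw [sum_prod_mul_apply_apply h₂.2 hj (fun x₂ x₂' => ∑ x₁, ∑ a, ∑ b, p₁ x₁ *
    (p₃ x₁ a * p₃ x₁ b * ∑ y, W x₁ x₂ a y * (if G x₁ x₂' b y then 1 else 0)))]
  simp_rw [Fintype.sum_prod_type, Finset.mul_sum]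
  simp_rw [Finset.sum_comm (γ := X₂) (α := X₁)]
  simp_rw [Finset.sum_comm (γ := X₂) (α := X₃)]
  refine Finset.sum_congr rfl fun x₁ _ => ?_
  refine Finset.sum_congr rfl fun x₃ _ => Finset.sum_congr rfl fun x₃' _ => ?_
  refine Finset.sum_congr rfl fun x₂ _ => Finset.sum_congr rfl fun x₂' _ => ?_
  refine Finset.sum_congr rfl fun y _ => ?_
  ring

/-- Different clouds are independent as wholes, so the satellites are independent even for `k = k'`.
-/
theorem pairProb_le₁₃ (h₁ : p₁ ∈ stdSimplex ℝ X₁) (h₂ : p₂ ∈ stdSimplex ℝ X₂)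
    (h₃ : ∀ x₁, p₃ x₁ ∈ stdSimplex ℝ X₃) (hW : ∀ x₁ x₂ x₃, W x₁ x₂ x₃ ∈ stdSimplex ℝ Y)
    {ε : ℝ} (hε : 0 ≤ ε)
    (hG : ∀ x₁ x₂ x₃ y, G x₁ x₂ x₃ y →
      ∑ a : X₁ × X₃, p₁ a.1 * p₃ a.1 a.2 * W a.1 x₂ a.2 y ≤ ε * W x₁ x₂ x₃ y)
    {i i' : Fin M₁} (j : Fin M₂) (k k' : Fin M₃) (hi : i ≠ i') :
    pairProb p₁ p₂ p₃ W G (i, j, k) (i', j, k') ≤ ε := by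
  classical
  refine le_trans (le_of_eq ?_) (collision_le (V := fun x₂ (a : X₁ × X₃) => W a.1 x₂ a.2)
    (G := fun x₂ b y => G b.1 x₂ b.2 y) hε h₂ (fun _ => mul_mem_stdSimplex h₁ h₃)
    (fun c a => hW _ _ _) (fun x₂ b y h => hG b.1 x₂ b.2 y h))
  unfold pairProb
  have h := fun c₂ : Fin M₂ → X₂ => sum_book_clouds h₁ h₃ hi k k'
    (fun x₁ x₃ x₁' x₃' => ∑ y, W x₁ (c₂ j) x₃ y * (if G x₁' (c₂ j) x₃' y then 1 else 0))
  simp_rw [h]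
  rw [sum_prod_mul_apply h₂.2 j (fun x₂ => ∑ a : X₁ × X₃, ∑ b : X₁ × X₃,
    p₁ a.1 * p₃ a.1 a.2 * (p₁ b.1 * p₃ b.1 b.2) *
      ∑ y, W a.1 x₂ a.2 y * (if G b.1 x₂ b.2 y then 1 else 0))]

theorem pairProb_le₁₂₃ (h₁ : p₁ ∈ stdSimplex ℝ X₁) (h₂ : p₂ ∈ stdSimplex ℝ X₂)
    (h₃ : ∀ x₁, p₃ x₁ ∈ stdSimplex ℝ X₃) (hW : ∀ x₁ x₂ x₃, W x₁ x₂ x₃ ∈ stdSimplex ℝ Y)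
    {ε : ℝ} (hε : 0 ≤ ε)
    (hG : ∀ x₁ x₂ x₃ y, G x₁ x₂ x₃ y → ∑ a : X₂ × X₁ × X₃,
      p₂ a.1 * (p₁ a.2.1 * p₃ a.2.1 a.2.2) * W a.2.1 a.1 a.2.2 y ≤ ε * W x₁ x₂ x₃ y)
    {i i' : Fin M₁} {j j' : Fin M₂} (k k' : Fin M₃) (hi : i ≠ i') (hj : j ≠ j') :
    pairProb p₁ p₂ p₃ W G (i, j, k) (i', j', k') ≤ ε := by
  classical
  refine le_trans (le_of_eq ?_) (collision_le (C := Unit) (r := fun _ => 1)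
    (V := fun _ (a : X₂ × X₁ × X₃) => W a.2.1 a.1 a.2.2)
    (G := fun _ b y => G b.2.1 b.1 b.2.2 y) hε ⟨fun _ => zero_le_one, by simp⟩
    (fun _ => mul_mem_stdSimplex h₂ fun _ => mul_mem_stdSimplex h₁ h₃)
    (fun c a => hW _ _ _) (fun x₂ b y h => hG b.2.1 b.1 b.2.2 y h))
  unfold pairProb
  have h := fun c₂ : Fin M₂ → X₂ => sum_book_clouds h₁ h₃ hi k k'
    (fun x₁ x₃ x₁' x₃' => ∑ y, W x₁ (c₂ j) x₃ y * (if G x₁' (c₂ j') x₃' y then 1 else 0))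
  simp_rw [h]
  rw [sum_prod_mul_apply_apply h₂.2 hj (fun x₂ x₂' => ∑ a : X₁ × X₃, ∑ b : X₁ × X₃,
    p₁ a.1 * p₃ a.1 a.2 * (p₁ b.1 * p₃ b.1 b.2) *
      ∑ y, W a.1 x₂ a.2 y * (if G b.1 x₂' b.2 y then 1 else 0))]
  rw [Fintype.sum_unique (ι := Unit), one_mul, Fintype.sum_prod_type]
  refine Finset.sum_congr rfl fun x₂ _ => ?_
  simp_rw [Fintype.sum_prod_type (α₁ := X₂), Finset.mul_sum]
  rw [Finset.sum_comm]
  refine Finset.sum_congr rfl fun a _ => Finset.sum_congr rfl fun x₂' _ => ?_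
  refine Finset.sum_congr rfl fun b _ => Finset.sum_congr rfl fun y _ => ?_
  ring

end

/-! ### Single-shot random coding bound. -/

section

variable {X₁ X₂ X₃ Y : Type*} [Fintype X₁] [Fintype X₂] [Fintype X₃] [Fintype Y]
  {p₁ : X₁ → ℝ} {p₂ : X₂ → ℝ} {p₃ : X₁ → X₃ → ℝ} {W : X₁ → X₂ → X₃ → Y → ℝ} {M₁ M₂ M₃ : ℕ}
  {G : X₁ → X₂ → X₃ → Y → Prop}

open Classical in
/-- The decoder that looks for the unique message whose codeword satisfies `G` with the output
errs only if the true codeword fails `G` or a wrong one satisfies it. -/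
theorem exists_decoder {𝓦 X Y : Type*} [Fintype 𝓦] [DecidableEq 𝓦] [Nonempty 𝓦]
    (x : 𝓦 → X) (G : X → Y → Prop) :
    ∃ h : Y → 𝓦, ∀ w y, (if h y ≠ w then 1 else 0 : ℝ) ≤
      ∑ w', if w' = w then (if G (x w') y then 0 else 1) else if G (x w') y then 1 else 0 := by
  -- Uniqueness need not be tested: any message satisfying `G` is chosen, and if it is wrong its own
  -- term in the sum is already `1`.
  refine ⟨fun y => if h : ∃ w, G (x w) y then h.choose else Classical.arbitrary 𝓦, fun w y => ?_⟩
  have h0 : ∀ w' ∈ (Finset.univ : Finset 𝓦), (0 : ℝ) ≤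
      if w' = w then (if G (x w') y then 0 else 1) else if G (x w') y then 1 else 0 := by
    intro w' _
    split_ifs <;> norm_num
  by_cases hw : ∃ w, G (x w) y
  · simp only [hw, dif_pos]
    set v := hw.choose with hv
    have hGv : G (x v) y := hw.choose_spec
    by_cases hvw : v = w
    · rw [if_neg (by simpa using hvw)]
      exact Finset.sum_nonneg h0
    · rw [if_pos hvw]
      refine le_trans (le_of_eq ?_) (Finset.single_le_sum h0 (Finset.mem_univ v))
      rw [if_neg hvw, if_pos hGv]
  · have : ¬ G (x w) y := fun h => hw ⟨w, h⟩
    refine le_trans ?_ (Finset.single_le_sum h0 (Finset.mem_univ w))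
    rw [if_pos rfl, if_neg this]
    split_ifs <;> norm_num

/-- A bound on the probability of confusing the messages `w` and `w'`. -/
noncomputable def confusion (B ε₂ ε₃ ε₁₃ ε₂₃ ε₁₂₃ : ℝ) (w w' : Fin M₁ × Fin M₂ × Fin M₃) : ℝ :=
  if w'.1 = w.1 then
    if w'.2.1 = w.2.1 then (if w'.2.2 = w.2.2 then B else ε₃)
    else (if w'.2.2 = w.2.2 then ε₂ else ε₂₃)
  else if w'.2.1 = w.2.1 then ε₁₃ else ε₁₂₃

/-- Once the first message is wrong, the relay message is unrestricted, hence the factor `M₃` and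
not `M₃ - 1`. -/
theorem sum_confusion (B ε₂ ε₃ ε₁₃ ε₂₃ ε₁₂₃ : ℝ) (w : Fin M₁ × Fin M₂ × Fin M₃) :
    ∑ w', confusion B ε₂ ε₃ ε₁₃ ε₂₃ ε₁₂₃ w w' = B + (M₂ - 1) * ε₂ + (M₃ - 1) * ε₃ +
      (M₁ - 1) * M₃ * ε₁₃ + (M₂ - 1) * (M₃ - 1) * ε₂₃ + (M₁ - 1) * (M₂ - 1) * M₃ * ε₁₂₃ := by
  have h1 : ∀ (i : Fin M₁) (j : Fin M₂), ∑ k : Fin M₃, confusion B ε₂ ε₃ ε₁₃ ε₂₃ ε₁₂₃ w (i, j, k)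
      = if i = w.1 then
          if j = w.2.1 then B + (M₃ - 1) * ε₃ else ε₂ + (M₃ - 1) * ε₂₃
        else if j = w.2.1 then M₃ * ε₁₃ else M₃ * ε₁₂₃ := by
    intro i j
    unfold confusion
    split_ifs <;> simp [sum_fin_ite_eq, *]
  have h2 : ∀ i : Fin M₁, (∑ j : Fin M₂, if i = w.1 then
          if j = w.2.1 then B + (M₃ - 1) * ε₃ else ε₂ + (M₃ - 1) * ε₂₃
        else if j = w.2.1 then M₃ * ε₁₃ else M₃ * ε₁₂₃)
      = if i = w.1 then B + (M₃ - 1) * ε₃ + (M₂ - 1) * (ε₂ + (M₃ - 1) * ε₂₃)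
        else M₃ * ε₁₃ + (M₂ - 1) * (M₃ * ε₁₂₃) := by
    intro i
    split_ifs <;> rw [sum_fin_ite_eq]
  simp_rw [Fintype.sum_prod_type, h1, h2, sum_fin_ite_eq]
  ring

open Classical in
/-- Single-shot random coding bound for superposition codes with threshold decoding. -/
theorem exists_code_avgErrorProb_le (h₁ : p₁ ∈ stdSimplex ℝ X₁) (h₂ : p₂ ∈ stdSimplex ℝ X₂)
    (h₃ : ∀ x₁, p₃ x₁ ∈ stdSimplex ℝ X₃) (hW : ∀ x₁ x₂ x₃, W x₁ x₂ x₃ ∈ stdSimplex ℝ Y)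
    {ε₂ ε₃ ε₁₃ ε₂₃ ε₁₂₃ : ℝ} (hε₂ : 0 ≤ ε₂) (hε₃ : 0 ≤ ε₃) (hε₁₃ : 0 ≤ ε₁₃) (hε₂₃ : 0 ≤ ε₂₃)
    (hε₁₂₃ : 0 ≤ ε₁₂₃)
    (hG₂ : ∀ x₁ x₂ x₃ y, G x₁ x₂ x₃ y → ∑ a, p₂ a * W x₁ a x₃ y ≤ ε₂ * W x₁ x₂ x₃ y)
    (hG₃ : ∀ x₁ x₂ x₃ y, G x₁ x₂ x₃ y → ∑ a, p₃ x₁ a * W x₁ x₂ a y ≤ ε₃ * W x₁ x₂ x₃ y)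
    (hG₁₃ : ∀ x₁ x₂ x₃ y, G x₁ x₂ x₃ y →
      ∑ a : X₁ × X₃, p₁ a.1 * p₃ a.1 a.2 * W a.1 x₂ a.2 y ≤ ε₁₃ * W x₁ x₂ x₃ y)
    (hG₂₃ : ∀ x₁ x₂ x₃ y, G x₁ x₂ x₃ y →
      ∑ a : X₂ × X₃, p₂ a.1 * p₃ x₁ a.2 * W x₁ a.1 a.2 y ≤ ε₂₃ * W x₁ x₂ x₃ y)
    (hG₁₂₃ : ∀ x₁ x₂ x₃ y, G x₁ x₂ x₃ y → ∑ a : X₂ × X₁ × X₃,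
      p₂ a.1 * (p₁ a.2.1 * p₃ a.2.1 a.2.2) * W a.2.1 a.1 a.2.2 y ≤ ε₁₂₃ * W x₁ x₂ x₃ y)
    (hM₁ : 0 < M₁) (hM₂ : 0 < M₂) (hM₃ : 0 < M₃) :
    ∃ (f₁ : Fin M₁ → X₁) (f₂ : Fin M₂ → X₂) (f₃ : Fin M₁ → Fin M₃ → X₃)
      (h : Y → Fin M₁ × Fin M₂ × Fin M₃),
      (∑ w₁, ∑ w₂, ∑ w₃, ∑ y, if h y ≠ (w₁, w₂, w₃) then
          W (f₁ w₁) (f₂ w₂) (f₃ w₁ w₃) y else 0) / ((M₁ : ℝ) * M₂ * M₃) ≤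
        (∑ x₂, p₂ x₂ * ∑ a : X₁ × X₃, p₁ a.1 * p₃ a.1 a.2 *
          ∑ y, W a.1 x₂ a.2 y * (if ¬ G a.1 x₂ a.2 y then 1 else 0)) +
        (M₂ - 1) * ε₂ + (M₃ - 1) * ε₃ + (M₁ - 1) * M₃ * ε₁₃ + (M₂ - 1) * (M₃ - 1) * ε₂₃ +
        (M₁ - 1) * (M₂ - 1) * M₃ * ε₁₂₃ := by
  have : Nonempty (Fin M₁ × Fin M₂ × Fin M₃) := ⟨⟨0, hM₁⟩, ⟨0, hM₂⟩, ⟨0, hM₃⟩⟩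
  set B := ∑ x₂, p₂ x₂ * ∑ a : X₁ × X₃, p₁ a.1 * p₃ a.1 a.2 *
          ∑ y, W a.1 x₂ a.2 y * (if ¬ G a.1 x₂ a.2 y then 1 else 0) with hB
  let C := (Fin M₂ → X₂) × (Fin M₁ → X₁ × (Fin M₃ → X₃))
  let P : C → ℝ := fun c => (∏ k, p₂ (c.1 k)) * ∏ k, cloudWeight p₁ p₃ (c.2 k)
  have hP : P ∈ stdSimplex ℝ C := by
    refine mul_mem_stdSimplex (p := fun c₂ : Fin M₂ → X₂ => ∏ k, p₂ (c₂ k))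
      (s := fun _ (c : Fin M₁ → X₁ × (Fin M₃ → X₃)) => ∏ k, cloudWeight p₁ p₃ (c k))
      ⟨fun c => Finset.prod_nonneg fun k _ => h₂.1 _, ?_⟩
      fun _ => ⟨fun c => Finset.prod_nonneg fun k _ => (cloudWeight_mem h₁ h₃).1 _, ?_⟩
    · exact sum_prod_eq_one (μ := fun _ => p₂) fun _ => h₂.2
    · exact sum_prod_eq_one (μ := fun _ => cloudWeight p₁ p₃) fun _ => (cloudWeight_mem h₁ h₃).2
  let x : C → Fin M₁ × Fin M₂ × Fin M₃ → X₁ × X₂ × X₃ := fun c w =>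
    ((c.2 w.1).1, c.1 w.2.1, (c.2 w.1).2 w.2.2)
  let V : X₁ × X₂ × X₃ → Y → ℝ := fun a => W a.1 a.2.1 a.2.2
  have hV : ∀ a, V a ∈ stdSimplex ℝ Y := fun a => hW _ _ _
  choose h hh using fun c => exists_decoder (x c) (fun a y => G a.1 a.2.1 a.2.2 y)
  -- The term of `w'` in the union bound for a fixed codebook: rejection of the true message when
  -- `w' = w`, acceptance of a wrong one otherwise.
  let D : C → Fin M₁ × Fin M₂ × Fin M₃ → Fin M₁ × Fin M₂ × Fin M₃ → ℝ := fun c w w' =>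
    ∑ y, V (x c w) y * if w' = w then
      (if G (x c w').1 (x c w').2.1 (x c w').2.2 y then 0 else 1)
      else if G (x c w').1 (x c w').2.1 (x c w').2.2 y then 1 else 0
  have herr : ∀ c w, ∑ y, (if h c y ≠ w then V (x c w) y else 0) ≤ ∑ w', D c w w' := by
    intro c w
    simp only [D]
    rw [Finset.sum_comm]
    refine Finset.sum_le_sum fun y _ => ?_
    rw [← Finset.mul_sum]
    refine le_trans (le_of_eq ?_) (mul_le_mul_of_nonneg_left (hh c w y) ((hV _).1 y))
    split_ifs <;> simp
  have hD : ∀ w w', ∑ c, P c * D c w w' ≤ confusion B ε₂ ε₃ ε₁₃ ε₂₃ ε₁₂₃ w w' := by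
    intro w w'
    by_cases hww : w' = w
    · subst hww
      have h4 : pairProb p₁ p₂ p₃ W (fun a b c d => ¬ G a b c d) w' w' = B := by
        rw [hB]
        convert pairProb_self h₁ h₂ h₃ w'
      simp only [confusion, if_true]
      rw [← h4]
      refine le_of_eq ?_
      simp only [pairProb, P, D, C, Fintype.sum_prod_type, V, x, if_true]
      have hnot : ∀ p : Prop, @ite ℝ (¬ p) (Classical.propDecidable _) 1 0
          = if p then 0 else 1 := by
        intro p
        by_cases hp : p <;> simp [hp]
      simp_rw [mul_assoc, ← Finset.mul_sum, hnot]
    · have h5 : ∑ c, P c * D c w w' = pairProb p₁ p₂ p₃ W G w w' := by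
        simp only [pairProb, P, D, C, Fintype.sum_prod_type, V, x, hww, if_false]
        simp_rw [mul_assoc, ← Finset.mul_sum]
      rw [h5]
      obtain ⟨i, j, k⟩ := w
      obtain ⟨i', j', k'⟩ := w'
      simp only [confusion]
      by_cases hi : i' = i
      · subst hi
        by_cases hj : j' = j
        · subst hj
          have hk : k' ≠ k := fun hk => hww (by rw [hk])
          simp only [hk, if_true, if_false]
          exact pairProb_le₃ h₁ h₂ h₃ hW hε₃ hG₃ _ _ hk.symm
        · by_cases hk : k' = k
          · subst hk
            simp only [hj, if_true, if_false]
            exact pairProb_le₂ h₁ h₂ h₃ hW hε₂ hG₂ _ _ (Ne.symm hj)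
          · simp only [hj, hk, if_true, if_false]
            exact pairProb_le₂₃ h₁ h₂ h₃ hW hε₂₃ hG₂₃ _ (Ne.symm hj) (Ne.symm hk)
      · by_cases hj : j' = j
        · subst hj
          simp only [hi, if_true, if_false]
          exact pairProb_le₁₃ h₁ h₂ h₃ hW hε₁₃ hG₁₃ _ _ _ (Ne.symm hi)
        · simp only [hi, hj, if_false]
          exact pairProb_le₁₂₃ h₁ h₂ h₃ hW hε₁₂₃ hG₁₂₃ _ _ (Ne.symm hi) (Ne.symm hj)
  have hM : (0 : ℝ) < (M₁ : ℝ) * M₂ * M₃ := by positivity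
  obtain ⟨c, hc⟩ := exists_le_of_sum_le hP
    (F := fun c => (∑ w, ∑ w', D c w w') / ((M₁ : ℝ) * M₂ * M₃))
    (B := B + (M₂ - 1) * ε₂ + (M₃ - 1) * ε₃ + (M₁ - 1) * M₃ * ε₁₃ + (M₂ - 1) * (M₃ - 1) * ε₂₃ +
        (M₁ - 1) * (M₂ - 1) * M₃ * ε₁₂₃) (by
      simp_rw [← mul_div_assoc]
      rw [← Finset.sum_div, div_le_iff₀ hM]
      calc ∑ c, P c * ∑ w, ∑ w', D c w w' = ∑ w, ∑ w', ∑ c, P c * D c w w' := by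
            simp_rw [Finset.mul_sum]
            rw [Finset.sum_comm]
            refine Finset.sum_congr rfl fun w _ => ?_
            rw [Finset.sum_comm]
        _ ≤ ∑ w, ∑ w', confusion B ε₂ ε₃ ε₁₃ ε₂₃ ε₁₂₃ w w' :=
            Finset.sum_le_sum fun w _ => Finset.sum_le_sum fun w' _ => hD w w'
        _ = _ := by
            simp_rw [sum_confusion]
            simp
            ring)
  refine ⟨fun i => (c.2 i).1, c.1, fun i k => (c.2 i).2 k, h c, le_trans ?_ hc⟩
  refine div_le_div_of_nonneg_right ?_ hM.le
  refine le_trans (le_of_eq ?_) (Finset.sum_le_sum fun w _ => herr c w)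
  simp only [Fintype.sum_prod_type, V, x]

end

/-! ### Mutual information in terms of input law and channel. -/

theorem sum_law_mul {Ω τ : Type*} [Fintype Ω] [Fintype τ] (P : Ω → ℝ) (T : Ω → τ) (F : τ → ℝ) :
    ∑ t, law P T t * F t = ∑ ω, P ω * F (T ω) := by
  classical
  simp_rw [law, Finset.sum_mul]
  rw [Finset.sum_comm]
  simp [ite_mul]

theorem condMutualInfo_eq_sum {Ω α β γ : Type*} [Fintype Ω] [Fintype α] [Fintype β]
    [Fintype γ] (P : Ω → ℝ) (X : Ω → α) (Y : Ω → β) (Z : Ω → γ) :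
    condMutualInfo P X Y Z = ∑ ω, P ω *
      Real.logb 2 (law P (fun ω => (X ω, Y ω, Z ω)) (X ω, Y ω, Z ω) * law P Z (Z ω) /
      (law P (fun ω => (X ω, Z ω)) (X ω, Z ω) * law P (fun ω => (Y ω, Z ω)) (Y ω, Z ω))) := by
  rw [← sum_law_mul P (fun ω => (X ω, Y ω, Z ω)) (fun t => Real.logb 2
    (law P (fun ω => (X ω, Y ω, Z ω)) t * law P Z t.2.2 /
      (law P (fun ω => (X ω, Z ω)) (t.1, t.2.2) * law P (fun ω => (Y ω, Z ω)) (t.2.1, t.2.2))))]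
  simp_rw [Fintype.sum_prod_type]
  rfl

open Classical in
/-- The conditional law of the output of the channel `V` with input law `p`, given that the
function `z` of the input has the value `c`. -/
noncomputable def outLaw {I Y γ : Type*} [Fintype I] (p : I → ℝ) (V : I → Y → ℝ) (z : I → γ)
    (c : γ) (y : Y) : ℝ :=
  (∑ i, if z i = c then p i * V i y else 0) / ∑ i, if z i = c then p i else 0

/-- The mutual information, in bits, between the input of the channel `V` and its output,
conditional on the function `z` of the input. -/
noncomputable def inputInfo {I Y γ : Type*} [Fintype I] [Fintype Y] (p : I → ℝ) (V : I → Y → ℝ)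
    (z : I → γ) : ℝ :=
  ∑ i, p i * ∑ y, V i y * Real.logb 2 (V i y / outLaw p V z (z i) y)

/-- By `hxz` the pair `(x, z)` determines the whole input, so `p i` cancels from the ratio of laws.
All five informations thus become `inputInfo` with different `z`. -/
theorem condMutualInfo_eq_inputInfo {Ω I Y α γ : Type*} [Fintype Ω] [Fintype I] [Fintype Y]
    [Fintype α] [Fintype γ] {p : I → ℝ} {V : I → Y → ℝ} (hV : ∀ i, V i ∈ stdSimplex ℝ Y)
    (e : I × Y ≃ Ω) {P : Ω → ℝ} (hP : ∀ i y, P (e (i, y)) = p i * V i y) {X : Ω → α}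
    {U : Ω → Y} {Z : Ω → γ} {x : I → α} {z : I → γ} (hX : ∀ i y, X (e (i, y)) = x i)
    (hU : ∀ i y, U (e (i, y)) = y) (hZ : ∀ i y, Z (e (i, y)) = z i)
    (hxz : ∀ i j, x i = x j → z i = z j → i = j) :
    condMutualInfo P X U Z = inputInfo p V z := by
  classical
  have hsum : ∀ F : Ω → ℝ, ∑ ω, F ω = ∑ i, ∑ y, F (e (i, y)) := by
    intro F
    rw [← Equiv.sum_comp e, Fintype.sum_prod_type]
  rw [condMutualInfo_eq_sum, hsum, inputInfo]
  refine Finset.sum_congr rfl fun i _ => ?_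
  rw [Finset.mul_sum]
  refine Finset.sum_congr rfl fun y _ => ?_
  have l1 : law P (fun ω => (X ω, U ω, Z ω)) (x i, y, z i) = p i * V i y := by
    rw [law, hsum]
    simp_rw [hX, hU, hZ, hP, Prod.mk.injEq]
    rw [Fintype.sum_eq_single i, Fintype.sum_eq_single y]
    · simp
    · intro y' hy
      simp [hy]
    · intro j hj
      refine Finset.sum_eq_zero fun y' _ => if_neg ?_
      rintro ⟨h1, -, h2⟩
      exact hj (hxz _ _ h1 h2)
  have l2 : law P (fun ω => (X ω, Z ω)) (x i, z i) = p i := by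
    rw [law, hsum]
    simp_rw [hX, hZ, hP, Prod.mk.injEq]
    rw [Fintype.sum_eq_single i]
    · simp [← Finset.mul_sum, (hV i).2]
    · intro j hj
      refine Finset.sum_eq_zero fun y' _ => if_neg ?_
      rintro ⟨h1, h2⟩
      exact hj (hxz _ _ h1 h2)
  have l3 : law P Z (z i) = ∑ j, if z j = z i then p j else 0 := by
    rw [law, hsum]
    simp_rw [hZ, hP]
    refine Finset.sum_congr rfl fun j _ => ?_
    split_ifs
    · rw [← Finset.mul_sum, (hV j).2, mul_one]
    · simp
  have l4 : law P (fun ω => (U ω, Z ω)) (y, z i) = ∑ j, if z j = z i then p j * V j y else 0 := by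
    rw [law, hsum]
    simp_rw [hU, hZ, hP, Prod.mk.injEq]
    refine Finset.sum_congr rfl fun j _ => ?_
    simp [ite_and]
  rw [hP, hX, hU, hZ, l1, l2, l3, l4, outLaw]
  by_cases hp : p i = 0
  · simp [hp]
  · rw [mul_assoc (p i) (V i y) (∑ j, _), mul_div_mul_left _ _ hp, div_div_eq_mul_div, mul_assoc]

section

variable {A X₁ X₂ X₃ Y : Type*}

/-- The law `p(q) p(x₂|q) p(x₁,x₃|q)` of `(Q, X₁, X₂, X₃)`. -/
def inputPmf (pQ : A → ℝ) (p₂ : A → X₂ → ℝ) (p₁₃ : A → X₁ × X₃ → ℝ) (i : A × X₁ × X₂ × X₃) : ℝ :=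
  pQ i.1 * p₂ i.1 i.2.2.1 * p₁₃ i.1 (i.2.1, i.2.2.2)

/-- The channel `W` as a function of the tuple `(q, x₁, x₂, x₃)`. -/
def tupleChannel (W : X₁ → X₂ → X₃ → Y → ℝ) (i : A × X₁ × X₂ × X₃) : Y → ℝ :=
  W i.2.1 i.2.2.1 i.2.2.2

/-- Regrouping of `(q, x₁, x₂, x₃, y)`. -/
def regroup : (A × X₁ × X₂ × X₃) × Y ≃ A × X₁ × X₂ × X₃ × Y where
  toFun t := (t.1.1, t.1.2.1, t.1.2.2.1, t.1.2.2.2, t.2)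
  invFun t := ((t.1, t.2.1, t.2.2.1, t.2.2.2.1), t.2.2.2.2)
  left_inv _ := rfl
  right_inv _ := rfl

variable [Fintype A] [Fintype X₁] [Fintype X₂] [Fintype X₃] [Fintype Y]

theorem rateBounds_iff {W : X₁ → X₂ → X₃ → Y → ℝ} (hW : ∀ x₁ x₂ x₃, W x₁ x₂ x₃ ∈ stdSimplex ℝ Y)
    (pQ : A → ℝ) (p₂ : A → X₂ → ℝ) (p₁₃ : A → X₁ × X₃ → ℝ) (R₁ R₂ R₃ : ℝ) :
    RateBounds (jointPmf pQ p₂ p₁₃ W) R₁ R₂ R₃ ↔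
      R₂ ≤ inputInfo (inputPmf pQ p₂ p₁₃) (tupleChannel W) (fun i => (i.2.1, i.2.2.2, i.1)) ∧
      R₃ ≤ inputInfo (inputPmf pQ p₂ p₁₃) (tupleChannel W) (fun i => (i.2.1, i.2.2.1, i.1)) ∧
      R₁ + R₃ ≤ inputInfo (inputPmf pQ p₂ p₁₃) (tupleChannel W) (fun i => (i.2.2.1, i.1)) ∧
      R₂ + R₃ ≤ inputInfo (inputPmf pQ p₂ p₁₃) (tupleChannel W) (fun i => (i.2.1, i.1)) ∧
      R₁ + R₂ + R₃ ≤ inputInfo (inputPmf pQ p₂ p₁₃) (tupleChannel W) (fun i => i.1) := by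
  have hV : ∀ i : A × X₁ × X₂ × X₃, tupleChannel W i ∈ stdSimplex ℝ Y := fun i => hW _ _ _
  have hP : ∀ i y, jointPmf pQ p₂ p₁₃ W (regroup (i, y))
      = inputPmf pQ p₂ p₁₃ i * tupleChannel W i y := fun _ _ => rfl
  rw [← condMutualInfo_eq_inputInfo hV regroup hP (x := fun i => i.2.2.1) (fun _ _ => rfl)
      (U := fun (_, _, _, _, y) => y) (fun _ _ => rfl)
      (Z := fun (q, x₁, _, x₃, _) => (x₁, x₃, q)) (X := fun (_, _, x₂, _, _) => x₂)
      (fun _ _ => rfl) (by simp +contextual [Prod.ext_iff]),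
    ← condMutualInfo_eq_inputInfo hV regroup hP (x := fun i => i.2.2.2) (fun _ _ => rfl)
      (U := fun (_, _, _, _, y) => y) (fun _ _ => rfl)
      (Z := fun (q, x₁, x₂, _, _) => (x₁, x₂, q)) (X := fun (_, _, _, x₃, _) => x₃)
      (fun _ _ => rfl) (by simp +contextual [Prod.ext_iff]),
    ← condMutualInfo_eq_inputInfo hV regroup hP (x := fun i => (i.2.1, i.2.2.2)) (fun _ _ => rfl)
      (U := fun (_, _, _, _, y) => y) (fun _ _ => rfl)
      (Z := fun (q, _, x₂, _, _) => (x₂, q)) (X := fun (_, x₁, _, x₃, _) => (x₁, x₃))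
      (fun _ _ => rfl) (by simp +contextual [Prod.ext_iff]),
    ← condMutualInfo_eq_inputInfo hV regroup hP (x := fun i => (i.2.2.1, i.2.2.2)) (fun _ _ => rfl)
      (U := fun (_, _, _, _, y) => y) (fun _ _ => rfl)
      (Z := fun (q, x₁, _, _, _) => (x₁, q)) (X := fun (_, _, x₂, x₃, _) => (x₂, x₃))
      (fun _ _ => rfl) (by simp +contextual [Prod.ext_iff]),
    ← condMutualInfo_eq_inputInfo hV regroup hP (x := fun i => (i.2.1, i.2.2.1, i.2.2.2))
      (fun _ _ => rfl) (U := fun (_, _, _, _, y) => y) (fun _ _ => rfl)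
      (Z := fun (q, _, _, _, _) => q) (X := fun (_, x₁, x₂, x₃, _) => (x₁, x₂, x₃))
      (fun _ _ => rfl) (by simp +contextual [Prod.ext_iff])]
  exact ⟨fun h => ⟨h.1, h.2, h.3, h.4, h.5⟩, fun h => ⟨h.1, h.2.1, h.2.2.1, h.2.2.2.1, h.2.2.2.2⟩⟩

end

/-! ### Gibbs' inequality and the Fano-type bound. -/

theorem outLaw_nonneg {I Y γ : Type*} [Fintype I] [Fintype Y] {p : I → ℝ} {V : I → Y → ℝ}
    (hp : ∀ i, 0 ≤ p i) (hV : ∀ i, V i ∈ stdSimplex ℝ Y) (z : I → γ) (c : γ) (y : Y) :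
    0 ≤ outLaw p V z c y := by
  refine div_nonneg (Finset.sum_nonneg fun i _ => ?_) (Finset.sum_nonneg fun i _ => ?_)
  · split_ifs
    exacts [mul_nonneg (hp i) ((hV i).1 y), le_rfl]
  · split_ifs
    exacts [hp i, le_rfl]

theorem outLaw_pos {I Y γ : Type*} [Fintype I] [Fintype Y] {p : I → ℝ} {V : I → Y → ℝ}
    (hp : ∀ i, 0 ≤ p i) (hV : ∀ i, V i ∈ stdSimplex ℝ Y) (z : I → γ) {i : I} {y : Y}
    (hi : 0 < p i) (hy : 0 < V i y) : 0 < outLaw p V z (z i) y := by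
  refine div_pos ?_ ?_
  · refine Finset.sum_pos' (fun j _ => ?_) ⟨i, Finset.mem_univ _, ?_⟩
    · split_ifs
      exacts [mul_nonneg (hp j) ((hV j).1 y), le_rfl]
    · rw [if_pos rfl]
      positivity
  · refine Finset.sum_pos' (fun j _ => ?_) ⟨i, Finset.mem_univ _, ?_⟩
    · split_ifs
      exacts [hp j, le_rfl]
    · rwa [if_pos rfl]

/-- Only an inequality, because `outLaw` is zero when the condition has probability zero. -/
theorem sum_outLaw_le_one {I Y γ : Type*} [Fintype I] [Fintype Y] {p : I → ℝ} {V : I → Y → ℝ}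
    (hV : ∀ i, V i ∈ stdSimplex ℝ Y) (z : I → γ) (c : γ) : ∑ y, outLaw p V z c y ≤ 1 := by
  classical
  unfold outLaw
  rw [← Finset.sum_div, Finset.sum_comm]
  refine le_trans (le_of_eq ?_) (div_self_le_one (∑ i, if z i = c then p i else 0))
  congr 1
  refine Finset.sum_congr rfl fun i _ => ?_
  split_ifs
  · rw [← Finset.mul_sum, (hV i).2, mul_one]
  · simp

/-- This is `log x ≤ x - 1` at `x = b * g / a`. Summed, it bounds a divergence from below by a free
test function `g`: the decoder's indicator yields Fano, `g = 1` yields nonnegativity. -/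
theorem gibbs_term {a b g : ℝ} (ha : 0 ≤ a) (hb : 0 ≤ b) (hg : 0 < g) (hab : 0 < a → 0 < b) :
    a * Real.logb 2 g + (a - b * g) / Real.log 2 ≤ a * Real.logb 2 (a / b) := by
  have h2 : 0 < Real.log 2 := Real.log_pos one_lt_two
  rcases ha.eq_or_lt with rfl | ha
  · simp only [zero_mul, zero_add, zero_sub]
    exact div_nonpos_of_nonpos_of_nonneg (by simpa using mul_nonneg hb hg.le) h2.le
  · have hb' := hab ha
    have h := Real.log_le_sub_one_of_pos (x := b * g / a) (by positivity)
    rw [Real.log_div (by positivity) ha.ne', Real.log_mul hb'.ne' hg.ne'] at h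
    have h3 := mul_le_mul_of_nonneg_left h ha.le
    have h4 : a * (b * g / a - 1) = b * g - a := by field_simp
    rw [h4] at h3
    rw [Real.logb, Real.logb, Real.log_div ha.ne' hb'.ne', ← mul_div_assoc, ← mul_div_assoc,
      ← add_div]
    refine div_le_div_of_nonneg_right ?_ h2.le
    linarith

open Classical in
/-- Fano-type bound: if the decoder `h` recovers the message of a block code, then the mutual
information between channel inputs and outputs given functions `z` of the inputs that depend
on the message `w` only through `v w` is at least the logarithm of the number of messages per
value of `v`. -/
theorem fano_le_inputInfo {𝓦 I Y γ 𝓥 : Type*} [Fintype 𝓦] [DecidableEq 𝓦] [Nonempty 𝓦]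
    [Fintype I] [Fintype Y]
    [Fintype 𝓥] {n : ℕ} (hn : 0 < n) {p : I → ℝ} {V : I → Y → ℝ} (hp0 : ∀ i, 0 ≤ p i)
    (hV : ∀ i, V i ∈ stdSimplex ℝ Y) (x : 𝓦 → Fin n → I)
    (hp : ∀ F : I → ℝ, ∑ i, p i * F i = (∑ w, ∑ t, F (x w t)) / (n * Fintype.card 𝓦))
    (z : I → γ) (v : 𝓦 → 𝓥) (hv : ∀ w w' t, v w = v w' → z (x w t) = z (x w' t))
    (h : (Fin n → Y) → 𝓦) :
    (∑ w, ∑ y : Fin n → Y, if h y = w then ∏ t, V (x w t) (y t) else 0) / Fintype.card 𝓦 *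
      Real.logb 2 (Fintype.card 𝓦 / Fintype.card 𝓥) - 1 ≤ n * inputInfo p V z := by
  have hN : (0 : ℝ) < Fintype.card 𝓦 := by exact_mod_cast Fintype.card_pos
  have hVne : Nonempty 𝓥 := ⟨v (Classical.arbitrary 𝓦)⟩
  have hNV : (0 : ℝ) < Fintype.card 𝓥 := by exact_mod_cast Fintype.card_pos
  have hn' : (0 : ℝ) < n := by exact_mod_cast hn
  set K : ℝ := Fintype.card 𝓦 / Fintype.card 𝓥 with hK
  have hK0 : 0 < K := by positivity
  let q : 𝓦 → Fin n → Y → ℝ := fun w t => outLaw p V z (z (x w t))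
  have hpx : ∀ w t, 0 < p (x w t) := by
    intro w t
    have := hp (fun i => if i = x w t then 1 else 0)
    simp only [mul_ite, mul_one, mul_zero, Finset.sum_ite_eq', Finset.mem_univ, if_true] at this
    rw [this]
    refine div_pos (Finset.sum_pos' (fun w' _ => Finset.sum_nonneg fun t' _ => ?_)
      ⟨w, Finset.mem_univ _, Finset.sum_pos' (fun t' _ => ?_) ⟨t, Finset.mem_univ _, ?_⟩⟩)
      (by positivity)
    · split_ifs <;> norm_num
    · split_ifs <;> norm_num
    · simp
  have hq0 : ∀ w t y, 0 ≤ q w t y := fun w t y => outLaw_nonneg hp0 hV z _ y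
  have hqpos : ∀ w t y, 0 < V (x w t) y → 0 < q w t y := fun w t y hy =>
    outLaw_pos hp0 hV z (hpx w t) hy
  have hqv : ∀ w w', v w = v w' → q w = q w' := by
    intro w w' hw
    funext t
    simp only [q]
    rw [hv w w' t hw]
  let a : 𝓦 → (Fin n → Y) → ℝ := fun w y => ∏ t, V (x w t) (y t)
  let b : 𝓦 → (Fin n → Y) → ℝ := fun w y => ∏ t, q w t (y t)
  have ha0 : ∀ w y, 0 ≤ a w y := fun w y => Finset.prod_nonneg fun t _ => (hV _).1 _
  have hb0 : ∀ w y, 0 ≤ b w y := fun w y => Finset.prod_nonneg fun t _ => hq0 _ _ _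
  have hVpos : ∀ w y, 0 < a w y → ∀ t, 0 < V (x w t) (y t) := by
    intro w y hay t
    refine lt_of_le_of_ne ((hV _).1 _) fun h0 => ?_
    rw [show a w y = 0 from Finset.prod_eq_zero (Finset.mem_univ t) h0.symm] at hay
    exact lt_irrefl _ hay
  have hab : ∀ w y, 0 < a w y → 0 < b w y := fun w y hay =>
    Finset.prod_pos fun t _ => hqpos _ _ _ (hVpos w y hay t)
  have ha1 : ∀ w, ∑ y, a w y = 1 := fun w => sum_prod_eq_one fun t => (hV _).2
  have hb1 : ∀ w, ∑ y, b w y ≤ 1 := by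
    intro w
    simp only [b]
    rw [sum_pi_prod]
    exact Finset.prod_le_one (fun t _ => Finset.sum_nonneg fun y _ => hq0 _ _ _)
      fun t _ => sum_outLaw_le_one hV z _
  -- `b w` depends only on `v w`, so decoding under `b` can collect at most one unit of mass per
  -- value of `v`.
  have hbG : ∑ w, ∑ y, (if h y = w then b w y else 0) ≤ Fintype.card 𝓥 := by
    rw [Finset.sum_comm]
    simp only [Finset.sum_ite_eq, Finset.mem_univ, if_true]
    -- A representative for each value of `v`; values not attained get an arbitrary message, which
    -- only adds nonnegative terms.
    let s : 𝓥 → 𝓦 := fun c => if hc : ∃ w, v w = c then hc.choose else Classical.arbitrary 𝓦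
    have hs : ∀ w, b (s (v w)) = b w := by
      intro w
      have hc : ∃ w', v w' = v w := ⟨w, rfl⟩
      have : v (s (v w)) = v w := by
        simp only [s, hc, dif_pos]
        exact hc.choose_spec
      funext y
      simp only [b, hqv _ _ this]
    calc ∑ y, b (h y) y ≤ ∑ y, ∑ c, b (s c) y := by
          refine Finset.sum_le_sum fun y _ => ?_
          rw [← hs (h y)]
          exact Finset.single_le_sum (f := fun c => b (s c) y) (fun c _ => hb0 _ _)
            (Finset.mem_univ (v (h y)))
      _ = ∑ c, ∑ y, b (s c) y := Finset.sum_comm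
      _ ≤ ∑ c : 𝓥, 1 := Finset.sum_le_sum fun c _ => hb1 _
      _ = _ := by simp
  -- The weights give `logb 2 g = logb 2 K - 1` on correct decoding and `-1` otherwise, while the
  -- total of `b * g` is at most `K / 2 * card 𝓥 + card 𝓦 / 2 = card 𝓦`.
  let g : 𝓦 → (Fin n → Y) → ℝ := fun w y => if h y = w then K / 2 else 1 / 2
  have hg0 : ∀ w y, 0 < g w y := by
    intro w y
    simp only [g]
    split_ifs <;> positivity
  have hbg : ∑ w, ∑ y, b w y * g w y ≤ Fintype.card 𝓦 := by
    calc ∑ w, ∑ y, b w y * g w y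
        ≤ ∑ w, ∑ y, (K / 2 * (if h y = w then b w y else 0) + 1 / 2 * b w y) := by
          refine Finset.sum_le_sum fun w _ => Finset.sum_le_sum fun y _ => ?_
          simp only [g]
          have := hb0 w y
          split_ifs <;> linarith
      _ = K / 2 * ∑ w, ∑ y, (if h y = w then b w y else 0) + 1 / 2 * ∑ w, ∑ y, b w y := by
          simp_rw [Finset.sum_add_distrib, Finset.mul_sum]
      _ ≤ K / 2 * Fintype.card 𝓥 + 1 / 2 * ∑ w : 𝓦, 1 := by
          gcongr with w _
          exact hb1 w
      _ = Fintype.card 𝓦 := by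
          rw [hK]
          simp
          field_simp
          norm_num
  have hlog : ∀ w y, a w y * Real.logb 2 (a w y / b w y)
      = ∑ t, a w y * Real.logb 2 (V (x w t) (y t) / q w t (y t)) := by
    intro w y
    rcases (ha0 w y).eq_or_lt with h0 | h0
    · simp [← h0]
    · have h1 : ∀ t, V (x w t) (y t) / q w t (y t) ≠ 0 := fun t =>
        (div_pos (hVpos w y h0 t) (hqpos _ _ _ (hVpos w y h0 t))).ne'
      rw [← Finset.mul_sum, ← Real.logb_prod _ _ fun t _ => h1 t, Finset.prod_div_distrib]
  -- Both `a` and `b` are products over time, so the divergence splits into single-letter terms.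
  have hinfo : n * inputInfo p V z * Fintype.card 𝓦
      = ∑ w, ∑ y, a w y * Real.logb 2 (a w y / b w y) := by
    rw [inputInfo, hp]
    simp_rw [hlog]
    have hsw : ∀ w, ∑ y, ∑ t, a w y * Real.logb 2 (V (x w t) (y t) / q w t (y t))
        = ∑ t, ∑ y, V (x w t) y * Real.logb 2 (V (x w t) y / q w t y) := by
      intro w
      rw [Finset.sum_comm]
      refine Finset.sum_congr rfl fun t _ => ?_
      exact sum_pi_prod_mul_apply (μ := fun t => V (x w t)) (fun t => (hV _).2) t
        (fun y => Real.logb 2 (V (x w t) y / q w t y))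
    simp_rw [hsw]
    field_simp
    rfl
  have hgibbs : ∑ w, ∑ y, (a w y * Real.logb 2 (g w y) + (a w y - b w y * g w y) / Real.log 2)
      ≤ ∑ w, ∑ y, a w y * Real.logb 2 (a w y / b w y) :=
    Finset.sum_le_sum fun w _ => Finset.sum_le_sum fun y _ =>
      gibbs_term (ha0 w y) (hb0 w y) (hg0 w y) (hab w y)
  have hsplit : ∑ w, ∑ y, (a w y * Real.logb 2 (g w y) + (a w y - b w y * g w y) / Real.log 2)
      = (∑ w, ∑ y, if h y = w then a w y else 0) * Real.logb 2 K - Fintype.card 𝓦 +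
        (Fintype.card 𝓦 - ∑ w, ∑ y, b w y * g w y) / Real.log 2 := by
    have hlg : ∀ w y, a w y * Real.logb 2 (g w y)
        = (if h y = w then a w y else 0) * Real.logb 2 K - a w y := by
      intro w y
      simp only [g]
      split_ifs
      · rw [Real.logb_div hK0.ne' two_ne_zero, Real.logb_self_eq_one one_lt_two]
        ring
      · rw [one_div, Real.logb_inv, Real.logb_self_eq_one one_lt_two]
        ring
    simp_rw [hlg, Finset.sum_add_distrib, Finset.sum_sub_distrib, ← Finset.sum_div,
      Finset.sum_sub_distrib, ha1, ← Finset.sum_mul]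
    simp
  have hnn : 0 ≤ (Fintype.card 𝓦 - ∑ w, ∑ y, b w y * g w y) / Real.log 2 :=
    div_nonneg (by linarith) (Real.log_pos one_lt_two).le
  rw [hsplit, ← hinfo] at hgibbs
  rw [div_mul_eq_mul_div, sub_le_iff_le_add, div_le_iff₀ hN]
  simp only [a] at hgibbs
  linarith

theorem inputInfo_nonneg {I Y γ : Type*} [Fintype I] [Fintype Y] {p : I → ℝ} {V : I → Y → ℝ}
    (hp : ∀ i, 0 ≤ p i) (hV : ∀ i, V i ∈ stdSimplex ℝ Y) (z : I → γ) : 0 ≤ inputInfo p V z := by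
  refine Finset.sum_nonneg fun i _ => ?_
  rcases (hp i).eq_or_lt with h0 | h0
  · simp [← h0]
  refine mul_nonneg h0.le ?_
  have h : ∑ y, (V i y * Real.logb 2 1 + (V i y - outLaw p V z (z i) y * 1) / Real.log 2)
      ≤ ∑ y, V i y * Real.logb 2 (V i y / outLaw p V z (z i) y) :=
    Finset.sum_le_sum fun y _ => gibbs_term ((hV i).1 y) (outLaw_nonneg hp hV z _ y) one_pos
      fun hy => outLaw_pos hp hV z h0 hy
  refine le_trans ?_ h
  simp only [Real.logb_one, mul_zero, zero_add, mul_one]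
  rw [← Finset.sum_div, Finset.sum_sub_distrib, (hV i).2]
  exact div_nonneg (by linarith [sum_outLaw_le_one (p := p) hV z (z i)])
    (Real.log_pos one_lt_two).le

/-! ### Converse: single-letter laws induced by a code. -/

open Classical in
/-- The law of `f k` for a uniformly distributed index `k`. -/
noncomputable def empirical {κ α : Type*} [Fintype κ] (f : κ → α) (a : α) : ℝ :=
  (∑ k, if f k = a then 1 else 0) / Fintype.card κ

theorem sum_empirical_mul {κ α : Type*} [Fintype κ] [Fintype α] (f : κ → α) (F : α → ℝ) :
    ∑ a, empirical f a * F a = (∑ k, F (f k)) / Fintype.card κ := by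
  classical
  simp_rw [empirical, div_mul_eq_mul_div]
  rw [← Finset.sum_div]
  congr 1
  simp_rw [Finset.sum_mul]
  rw [Finset.sum_comm]
  simp

theorem empirical_mem {κ α : Type*} [Fintype κ] [Nonempty κ] [Fintype α] (f : κ → α) :
    empirical f ∈ stdSimplex ℝ α := by
  classical
  refine ⟨fun a => div_nonneg (Finset.sum_nonneg fun k _ => ?_) (Nat.cast_nonneg _), ?_⟩
  · split_ifs <;> norm_num
  · have := sum_empirical_mul f fun _ => 1
    simpa using this

theorem numMessages_pos (R : ℝ) (n : ℕ) : 0 < numMessages R n :=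
  Nat.ceil_pos.2 (by positivity)

theorem le_logb_numMessages (R : ℝ) (n : ℕ) : n * R ≤ Real.logb 2 (numMessages R n) := by
  rw [Real.le_logb_iff_rpow_le one_lt_two (by exact_mod_cast numMessages_pos R n)]
  exact Nat.le_ceil _

section

variable {X₁ X₂ X₃ Y : Type*} {M₁ M₂ M₃ n : ℕ}

/-- The product of the two empirical laws at time `t` is the joint empirical law, since `f₂` reads
only `w₂` and `(f₁, f₃)` only `(w₁, w₃)`. -/
theorem Code.sum_inputPmf_mul [Fintype X₁] [Fintype X₂] [Fintype X₃]
    (c : Code X₁ X₂ X₃ Y M₁ M₂ M₃ n)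
    (F : Fin n × X₁ × X₂ × X₃ → ℝ) :
    ∑ i, inputPmf (fun _ => 1 / (n : ℝ)) (fun t => empirical fun w => c.f₂ w t)
        (fun t => empirical fun w : Fin M₁ × Fin M₃ => (c.f₁ w.1 t, c.f₃ w.1 w.2 t)) i * F i =
      (∑ w : Fin M₁ × Fin M₂ × Fin M₃,
        ∑ t, F (t, c.f₁ w.1 t, c.f₂ w.2.1 t, c.f₃ w.1 w.2.2 t)) /
        (n * Fintype.card (Fin M₁ × Fin M₂ × Fin M₃)) := by
  have h : ∀ t, ∑ a : X₁ × X₂ × X₃, inputPmf (fun _ => 1 / (n : ℝ))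
        (fun t => empirical fun w => c.f₂ w t)
        (fun t => empirical fun w : Fin M₁ × Fin M₃ => (c.f₁ w.1 t, c.f₃ w.1 w.2 t)) (t, a) *
          F (t, a) =
      1 / (n : ℝ) * ∑ x₂, empirical (fun w => c.f₂ w t) x₂ * ∑ b : X₁ × X₃,
        empirical (fun w : Fin M₁ × Fin M₃ => (c.f₁ w.1 t, c.f₃ w.1 w.2 t)) b *
          F (t, b.1, x₂, b.2) := by
    intro t
    simp_rw [Finset.mul_sum, inputPmf, Fintype.sum_prod_type, mul_assoc]
    rw [Finset.sum_comm]
  simp_rw [Fintype.sum_prod_type (α₁ := Fin n), h, sum_empirical_mul, Fintype.sum_prod_type]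
  rw [← Finset.mul_sum]
  simp_rw [← Finset.sum_div]
  simp only [Fintype.card_prod, Fintype.card_fin, Nat.cast_mul]
  have hs : ∑ i, ∑ k, ∑ x, ∑ y, F (i, c.f₁ x i, c.f₂ k i, c.f₃ x y i)
      = ∑ x, ∑ k, ∑ y, ∑ i, F (i, c.f₁ x i, c.f₂ k i, c.f₃ x y i) := by
    simp_rw [Finset.sum_comm (γ := Fin n)]
    rw [Finset.sum_comm]
  rw [hs, div_div, div_mul_div_comm, one_mul]
  congr 1
  ring

theorem Code.sum_correct [Fintype Y] (c : Code X₁ X₂ X₃ Y M₁ M₂ M₃ n)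
    {W : X₁ → X₂ → X₃ → Y → ℝ}
    (hW : ∀ x₁ x₂ x₃, W x₁ x₂ x₃ ∈ stdSimplex ℝ Y) (hM₁ : 0 < M₁) (hM₂ : 0 < M₂) (hM₃ : 0 < M₃) :
    (∑ w : Fin M₁ × Fin M₂ × Fin M₃, ∑ y, if c.h y = w then
      ∏ t, W (c.f₁ w.1 t) (c.f₂ w.2.1 t) (c.f₃ w.1 w.2.2 t) (y t) else 0) /
        Fintype.card (Fin M₁ × Fin M₂ × Fin M₃) = 1 - c.avgErrorProb W := by
  have h : ∀ w : Fin M₁ × Fin M₂ × Fin M₃, (∑ y, if c.h y = w then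
      ∏ t, W (c.f₁ w.1 t) (c.f₂ w.2.1 t) (c.f₃ w.1 w.2.2 t) (y t) else 0)
      = 1 - c.errorProb W w.1 w.2.1 w.2.2 := by
    intro w
    rw [eq_sub_iff_add_eq, Code.errorProb, ← Finset.sum_add_distrib,
      ← sum_prod_eq_one (μ := fun t => W (c.f₁ w.1 t) (c.f₂ w.2.1 t) (c.f₃ w.1 w.2.2 t))
        fun _ => (hW _ _ _).2]
    refine Finset.sum_congr rfl fun y _ => ?_
    by_cases hy : c.h y = w <;> simp [hy]
  simp_rw [h]
  have hM : (M₁ : ℝ) * M₂ * M₃ ≠ 0 := by positivity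
  rw [Code.avgErrorProb]
  simp only [Finset.sum_sub_distrib, Fintype.sum_prod_type, Fintype.card_prod, Fintype.card_fin,
    Nat.cast_mul, ← mul_assoc, sub_div]
  congr 1
  simp
  field_simp

theorem Code.avgErrorProb_nonneg [Fintype Y] (c : Code X₁ X₂ X₃ Y M₁ M₂ M₃ n)
    {W : X₁ → X₂ → X₃ → Y → ℝ}
    (hW : ∀ x₁ x₂ x₃, W x₁ x₂ x₃ ∈ stdSimplex ℝ Y) : 0 ≤ c.avgErrorProb W := by
  refine div_nonneg (Finset.sum_nonneg fun w₁ _ => Finset.sum_nonneg fun w₂ _ =>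
    Finset.sum_nonneg fun w₃ _ => Finset.sum_nonneg fun y _ => ?_) (by positivity)
  split_ifs
  exacts [Finset.prod_nonneg fun t _ => (hW _ _ _).1 _, le_rfl]

theorem Code.avgErrorProb_le_one [Fintype Y] (c : Code X₁ X₂ X₃ Y M₁ M₂ M₃ n)
    {W : X₁ → X₂ → X₃ → Y → ℝ}
    (hW : ∀ x₁ x₂ x₃, W x₁ x₂ x₃ ∈ stdSimplex ℝ Y) (hM₁ : 0 < M₁) (hM₂ : 0 < M₂) (hM₃ : 0 < M₃) :
    c.avgErrorProb W ≤ 1 := by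
  rw [← sub_nonneg, ← c.sum_correct hW hM₁ hM₂ hM₃]
  refine div_nonneg (Finset.sum_nonneg fun w _ => Finset.sum_nonneg fun y _ => ?_) (by positivity)
  split_ifs
  exacts [Finset.prod_nonneg fun t _ => (hW _ _ _).1 _, le_rfl]

theorem Code.le_inputInfo [Fintype X₁] [Fintype X₂] [Fintype X₃] [Fintype Y]
    (c : Code X₁ X₂ X₃ Y M₁ M₂ M₃ n)
    {W : X₁ → X₂ → X₃ → Y → ℝ}
    (hW : ∀ x₁ x₂ x₃, W x₁ x₂ x₃ ∈ stdSimplex ℝ Y) (hn : 0 < n) (hM₁ : 0 < M₁) (hM₂ : 0 < M₂)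
    (hM₃ : 0 < M₃) {γ 𝓥 : Type*} [Fintype 𝓥] (z : Fin n × X₁ × X₂ × X₃ → γ)
    (v : Fin M₁ × Fin M₂ × Fin M₃ → 𝓥)
    (hv : ∀ w w' t, v w = v w' → z (t, c.f₁ w.1 t, c.f₂ w.2.1 t, c.f₃ w.1 w.2.2 t)
      = z (t, c.f₁ w'.1 t, c.f₂ w'.2.1 t, c.f₃ w'.1 w'.2.2 t)) {R : ℝ}
    (hR : n * R ≤ Real.logb 2 ((M₁ : ℝ) * M₂ * M₃ / Fintype.card 𝓥)) :
    (1 - c.avgErrorProb W) * R - 1 / n ≤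
      inputInfo (inputPmf (fun _ => 1 / (n : ℝ)) (fun t => empirical fun w => c.f₂ w t)
        (fun t => empirical fun w : Fin M₁ × Fin M₃ => (c.f₁ w.1 t, c.f₃ w.1 w.2 t)))
        (tupleChannel W) z := by
  classical
  have : Nonempty (Fin M₁) := ⟨⟨0, hM₁⟩⟩
  have : Nonempty (Fin M₂) := ⟨⟨0, hM₂⟩⟩
  have : Nonempty (Fin M₃) := ⟨⟨0, hM₃⟩⟩
  have hn' : (0 : ℝ) < n := by exact_mod_cast hn
  have h := fano_le_inputInfo (𝓦 := Fin M₁ × Fin M₂ × Fin M₃) hn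
    (p := inputPmf (fun _ => 1 / (n : ℝ)) (fun t => empirical fun w => c.f₂ w t)
        (fun t => empirical fun w : Fin M₁ × Fin M₃ => (c.f₁ w.1 t, c.f₃ w.1 w.2 t)))
    (V := tupleChannel W)
    (fun i => mul_nonneg (mul_nonneg (by positivity) ((empirical_mem _).1 _))
      ((empirical_mem _).1 _))
    (fun i => hW _ _ _) (fun w t => (t, c.f₁ w.1 t, c.f₂ w.2.1 t, c.f₃ w.1 w.2.2 t))
    c.sum_inputPmf_mul z v hv c.h
  have hcor := c.sum_correct hW hM₁ hM₂ hM₃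
  have h' : (1 - c.avgErrorProb W) * (n * R) - 1 ≤ n * inputInfo (inputPmf (fun _ => 1 / (n : ℝ))
      (fun t => empirical fun w => c.f₂ w t)
        (fun t => empirical fun w : Fin M₁ × Fin M₃ => (c.f₁ w.1 t, c.f₃ w.1 w.2 t)))
        (tupleChannel W) z := by
    refine le_trans ?_ h
    rw [← hcor]
    gcongr ?_ - 1
    refine le_trans (mul_le_mul_of_nonneg_left hR ?_) (le_of_eq ?_)
    · rw [hcor]
      linarith [c.avgErrorProb_le_one hW hM₁ hM₂ hM₃]
    · congr 2
      simp [mul_assoc]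
  rw [← mul_le_mul_iff_right₀ hn']
  refine le_trans (le_of_eq ?_) h'
  field_simp

end

/-- The region described by the mutual information bounds. -/
def rateRegion {X₁ X₂ X₃ Y : Type*} [Fintype X₁] [Fintype X₂] [Fintype X₃] [Fintype Y]
    (W : X₁ → X₂ → X₃ → Y → ℝ) : Set (ℝ × ℝ × ℝ) :=
  {R : ℝ × ℝ × ℝ | 0 ≤ R.1 ∧ 0 ≤ R.2.1 ∧ 0 ≤ R.2.2 ∧
    ∃ (k : ℕ) (pQ : Fin k → ℝ) (p₂ : Fin k → X₂ → ℝ) (p₁₃ : Fin k → X₁ × X₃ → ℝ),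
      pQ ∈ stdSimplex ℝ (Fin k) ∧ (∀ q, p₂ q ∈ stdSimplex ℝ X₂) ∧
      (∀ q, p₁₃ q ∈ stdSimplex ℝ (X₁ × X₃)) ∧
      RateBounds (jointPmf pQ p₂ p₁₃ W) R.1 R.2.1 R.2.2}

/-- Fano loses `r = 1 / n` once per sum of rates, but each rate is reduced by `r` and clipped at
`0`; if any clipped rate is positive, `r` has been subtracted at least once. -/
theorem max_add_max_le_info {a b r I : ℝ} (ha : 0 ≤ a) (hb : 0 ≤ b) (hr : 0 ≤ r) (hI : 0 ≤ I)
    (h : a + b - r ≤ I) : max 0 (a - r) + max 0 (b - r) ≤ I := by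
  rcases max_cases 0 (a - r) with h1 | h1 <;> rcases max_cases 0 (b - r) with h2 | h2 <;> linarith

theorem max_add_max_add_max_le_info {a b c r I : ℝ} (ha : 0 ≤ a) (hb : 0 ≤ b) (hc : 0 ≤ c)
    (hr : 0 ≤ r) (hI : 0 ≤ I) (h : a + b + c - r ≤ I) :
    max 0 (a - r) + max 0 (b - r) + max 0 (c - r) ≤ I := by
  rcases max_cases 0 (a - r) with h1 | h1 <;> rcases max_cases 0 (b - r) with h2 | h2 <;>
    rcases max_cases 0 (c - r) with h3 | h3 <;> linarith

theorem Code.mem_rateRegion {X₁ X₂ X₃ Y : Type*} [Fintype X₁] [Fintype X₂] [Fintype X₃]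
    [Fintype Y] {W : X₁ → X₂ → X₃ → Y → ℝ} (hW : ∀ x₁ x₂ x₃, W x₁ x₂ x₃ ∈ stdSimplex ℝ Y)
    {R₁ R₂ R₃ : ℝ} (hR₁ : 0 ≤ R₁) (hR₂ : 0 ≤ R₂) (hR₃ : 0 ≤ R₃) {n : ℕ} (hn : 0 < n)
    (c : Code X₁ X₂ X₃ Y (numMessages R₁ n) (numMessages R₂ n) (numMessages R₃ n) n) :
    (max 0 ((1 - c.avgErrorProb W) * R₁ - 1 / n), max 0 ((1 - c.avgErrorProb W) * R₂ - 1 / n),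
      max 0 ((1 - c.avgErrorProb W) * R₃ - 1 / n)) ∈ rateRegion W := by
  have hM₁ := numMessages_pos R₁ n
  have hM₂ := numMessages_pos R₂ n
  have hM₃ := numMessages_pos R₃ n
  have : Nonempty (Fin (numMessages R₁ n)) := ⟨⟨0, hM₁⟩⟩
  have : Nonempty (Fin (numMessages R₂ n)) := ⟨⟨0, hM₂⟩⟩
  have : Nonempty (Fin (numMessages R₃ n)) := ⟨⟨0, hM₃⟩⟩
  have hl₁ := le_logb_numMessages R₁ n
  have hl₂ := le_logb_numMessages R₂ n
  have hl₃ := le_logb_numMessages R₃ n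
  have hp₁ : (0 : ℝ) < numMessages R₁ n := by exact_mod_cast hM₁
  have hp₂ : (0 : ℝ) < numMessages R₂ n := by exact_mod_cast hM₂
  have hp₃ : (0 : ℝ) < numMessages R₃ n := by exact_mod_cast hM₃
  have hn' : (0 : ℝ) < n := by exact_mod_cast hn
  have hPe : 0 ≤ 1 - c.avgErrorProb W := sub_nonneg.2 (c.avgErrorProb_le_one hW hM₁ hM₂ hM₃)
  have hlog : ∀ {a b m : ℝ}, 0 < a → 0 < b → m = a * b →
      Real.logb 2 m = Real.logb 2 a + Real.logb 2 b := by
    rintro a b m ha hb rfl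
    exact Real.logb_mul ha.ne' hb.ne'
  refine ⟨le_max_left _ _, le_max_left _ _, le_max_left _ _, n, fun _ => 1 / (n : ℝ),
    fun t => empirical fun w => c.f₂ w t,
    fun t => empirical fun w : Fin (numMessages R₁ n) × Fin (numMessages R₃ n) =>
      (c.f₁ w.1 t, c.f₃ w.1 w.2 t), ⟨fun _ => by positivity, ?_⟩, fun _ => empirical_mem _,
    fun _ => empirical_mem _, ?_⟩
  · simp [hn'.ne']
  rw [rateBounds_iff hW]
  have h₁ := mul_nonneg hPe hR₁
  have h₂ := mul_nonneg hPe hR₂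
  have h₃ := mul_nonneg hPe hR₃
  have hr : (0 : ℝ) ≤ 1 / n := by positivity
  refine ⟨max_le ?_ ?_, max_le ?_ ?_, max_add_max_le_info h₁ h₃ hr ?_ ?_,
    max_add_max_le_info h₂ h₃ hr ?_ ?_, max_add_max_add_max_le_info h₁ h₂ h₃ hr ?_ ?_⟩
  case refine_1 | refine_3 | refine_5 | refine_7 | refine_9 =>
    exact inputInfo_nonneg (fun i => mul_nonneg (mul_nonneg (by positivity)
      ((empirical_mem _).1 _)) ((empirical_mem _).1 _)) (fun i => hW _ _ _) _
  -- In each of the five bounds `v` keeps the messages that determine the conditioning symbols; the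
  -- number of messages per value of `v` is the product of the remaining `Mᵢ`.
  · refine c.le_inputInfo hW hn hM₁ hM₂ hM₃ _ (fun w => (w.1, w.2.2)) ?_ ?_
    · simp +contextual [Prod.ext_iff]
    · refine hl₂.trans (le_of_eq (congrArg _ ?_))
      simp
      field_simp
  · refine c.le_inputInfo hW hn hM₁ hM₂ hM₃ _ (fun w => (w.1, w.2.1)) ?_ ?_
    · simp +contextual [Prod.ext_iff]
    · refine hl₃.trans (le_of_eq (congrArg _ ?_))
      simp
      field_simp
  · rw [← mul_add]
    refine c.le_inputInfo hW hn hM₁ hM₂ hM₃ _ (fun w => w.2.1) ?_ ?_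
    · simp +contextual
    · rw [hlog hp₁ hp₃ (by simp; field_simp)]
      linarith
  · rw [← mul_add]
    refine c.le_inputInfo hW hn hM₁ hM₂ hM₃ _ (fun w => w.1) ?_ ?_
    · simp +contextual
    · rw [hlog hp₂ hp₃ (by simp; field_simp)]
      linarith
  · rw [← mul_add, ← mul_add]
    refine c.le_inputInfo hW hn hM₁ hM₂ hM₃ _ (fun w => ()) ?_ ?_
    · simp
    · rw [hlog (mul_pos hp₁ hp₂) hp₃ (by simp), hlog hp₁ hp₂ rfl]
      linarith

theorem Achievable.mem_closure_rateRegion {X₁ X₂ X₃ Y : Type*} [Fintype X₁] [Fintype X₂]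
    [Fintype X₃] [Fintype Y] {W : X₁ → X₂ → X₃ → Y → ℝ}
    (hW : ∀ x₁ x₂ x₃, W x₁ x₂ x₃ ∈ stdSimplex ℝ Y) {R₁ R₂ R₃ : ℝ} (h : Achievable W R₁ R₂ R₃) :
    (R₁, R₂, R₃) ∈ closure (rateRegion W) := by
  obtain ⟨h₁, h₂, h₃, c, hc⟩ := h
  have hlim : ∀ {R : ℝ}, 0 ≤ R → Filter.Tendsto
      (fun n : ℕ => max 0 ((1 - (c n).avgErrorProb W) * R - 1 / n)) Filter.atTop (nhds R) := by
    intro R hR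
    have := (((tendsto_const_nhds (x := (1 : ℝ))).sub hc).mul_const R).sub
      tendsto_one_div_atTop_nhds_zero_nat
    have := (tendsto_const_nhds (x := (0 : ℝ))).max this
    simpa [hR] using this
  refine mem_closure_of_tendsto ((hlim h₁).prodMk_nhds ((hlim h₂).prodMk_nhds (hlim h₃))) ?_
  filter_upwards [Filter.eventually_gt_atTop 0] with n hn
  exact (c n).mem_rateRegion hW h₁ h₂ h₃ hn

/-! ### Achievability: concentration of likelihood ratios. -/

open Classical in
/-- Chernoff bound: sums of independent copies of a variable with negative mean are positive with
exponentially small probability. -/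
theorem exists_chernoff {Ω : Type*} [Fintype Ω] {m : Ω → ℝ} (hm : m ∈ stdSimplex ℝ Ω) (c : Ω → ℝ)
    (hc : ∑ ω, m ω * c ω < 0) : ∃ ρ : ℝ, 0 ≤ ρ ∧ ρ < 1 ∧ ∀ n : ℕ,
      ∑ ω : Fin n → Ω, (∏ t, m (ω t)) * (if 0 < ∑ t, c (ω t) then 1 else 0) ≤ ρ ^ n := by
  -- The moment generating function is `1` at zero with negative slope there, so it is below `1` at
  -- some `s > 0`; that value is `ρ`.
  let g : ℝ → ℝ := fun s => ∑ ω, m ω * Real.exp (s * c ω)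
  have hg0 : g 0 = 1 := by simp [g, hm.2]
  have hg : HasDerivAt g (∑ ω, m ω * c ω) 0 := by
    refine HasDerivAt.fun_sum fun ω _ => ?_
    have h : HasDerivAt (fun s : ℝ => s * c ω) (1 * c ω) 0 := (hasDerivAt_id' 0).mul_const _
    simpa using h.exp.const_mul (m ω)
  have hev := (hasDerivAt_iff_tendsto_slope.1 hg).eventually (gt_mem_nhds hc)
  have hev' : ∀ᶠ s in nhdsWithin (0 : ℝ) (Set.Ioi 0), slope g 0 s < 0 :=
    hev.filter_mono (nhdsWithin_mono _ fun s hs => ne_of_gt hs)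
  obtain ⟨s, hs, hs0⟩ := (hev'.and self_mem_nhdsWithin).exists
  have hs0 : 0 < s := hs0
  rw [slope_def_field, hg0, sub_zero, div_neg_iff] at hs
  have hs1 : g s < 1 := by
    rcases hs with h | h <;> linarith [h.1, h.2]
  refine ⟨g s, Finset.sum_nonneg fun ω _ => mul_nonneg (hm.1 ω) (Real.exp_pos _).le, hs1,
    fun n => ?_⟩
  calc _ ≤ ∑ ω : Fin n → Ω, ∏ t, (m (ω t) * Real.exp (s * c (ω t))) := by
        refine Finset.sum_le_sum fun ω _ => ?_
        rw [Finset.prod_mul_distrib, ← Real.exp_sum, ← Finset.mul_sum]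
        refine mul_le_mul_of_nonneg_left ?_ (Finset.prod_nonneg fun t _ => hm.1 _)
        split_ifs with h
        · exact Real.one_le_exp (by positivity)
        · exact (Real.exp_pos _).le
    _ = g s ^ n := by
        rw [sum_pi_prod (fun _ ω => m ω * Real.exp (s * c ω))]
        simp [g]

theorem sum_arrow_prod {κ α β : Type*} [Fintype κ] [DecidableEq κ] [Fintype α] [Fintype β]
    (F : (κ → α × β) → ℝ) : ∑ f, F f = ∑ a : κ → α, ∑ b : κ → β, F fun t => (a t, b t) := by
  rw [← Equiv.sum_comp (Equiv.arrowProdEquivProdArrow κ (fun _ => α) (fun _ => β)).symm,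
    Fintype.sum_prod_type]
  rfl

open Classical in
/-- The likelihood ratio of `n` channel uses exceeds `2 ^ (n T)`, up to an exponentially small
probability, if `T` is less than the expected logarithmic likelihood ratio. -/
theorem exists_threshold_bound {I Y : Type*} [Fintype I] [Fintype Y] {p : I → ℝ}
    (hp : p ∈ stdSimplex ℝ I) {V q : I → Y → ℝ} (hV : ∀ i, V i ∈ stdSimplex ℝ Y)
    (hq : ∀ i y, 0 < p i → 0 < V i y → 0 < q i y) {T : ℝ}
    (hT : T < ∑ i, p i * ∑ y, V i y * Real.logb 2 (V i y / q i y)) :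
    ∃ ρ : ℝ, 0 ≤ ρ ∧ ρ < 1 ∧ ∀ n : ℕ, ∑ i : Fin n → I, ∑ y : Fin n → Y,
      (∏ t, p (i t)) * (∏ t, V (i t) (y t)) *
        (if ∏ t, q (i t) (y t) ≤ (2 : ℝ) ^ (-((n : ℝ) * T)) * ∏ t, V (i t) (y t) then 0 else 1) ≤
        ρ ^ n := by
  have h2 : 0 < Real.log 2 := Real.log_pos one_lt_two
  have hm := mul_mem_stdSimplex hp hV
  -- The shortfall of the log-likelihood ratio below `T` has negative mean by `hT`; off null events
  -- the threshold can fail only if the shortfalls have positive sum.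
  obtain ⟨ρ, hρ0, hρ1, hρ⟩ := exists_chernoff hm
    (fun a => T - Real.logb 2 (V a.1 a.2 / q a.1 a.2)) (by
      simp_rw [mul_sub]
      rw [Finset.sum_sub_distrib, ← Finset.sum_mul, hm.2, one_mul, sub_neg]
      refine hT.trans_le (le_of_eq ?_)
      simp_rw [Fintype.sum_prod_type, Finset.mul_sum, mul_assoc])
  refine ⟨ρ, hρ0, hρ1, fun n => le_trans ?_ (hρ n)⟩
  rw [sum_arrow_prod]
  refine Finset.sum_le_sum fun i _ => Finset.sum_le_sum fun y _ => ?_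
  simp only [Finset.prod_mul_distrib]
  have hPn : 0 ≤ ∏ t, p (i t) := Finset.prod_nonneg fun t _ => hp.1 _
  have hVn : 0 ≤ ∏ t, V (i t) (y t) := Finset.prod_nonneg fun t _ => (hV _).1 _
  rcases (mul_nonneg hPn hVn).eq_or_lt with h0 | h0
  · simp [← h0]
  refine mul_le_mul_of_nonneg_left ?_ h0.le
  split_ifs with h1 h3 h3
  · exact zero_le_one
  · exact le_rfl
  · exact le_rfl
  · exfalso
    apply h1
    have hpt : ∀ t, 0 < p (i t) := fun t => lt_of_le_of_ne (hp.1 _) fun h =>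
      (left_ne_zero_of_mul h0.ne') (Finset.prod_eq_zero (Finset.mem_univ t) h.symm)
    have hVt : ∀ t, 0 < V (i t) (y t) := fun t => lt_of_le_of_ne ((hV _).1 _) fun h =>
      (right_ne_zero_of_mul h0.ne') (Finset.prod_eq_zero (Finset.mem_univ t) h.symm)
    have hqt : ∀ t, 0 < q (i t) (y t) := fun t => hq _ _ (hpt t) (hVt t)
    have hQ : 0 < ∏ t, q (i t) (y t) := Finset.prod_pos fun t _ => hqt t
    have hVV : 0 < ∏ t, V (i t) (y t) := Finset.prod_pos fun t _ => hVt t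
    rw [not_lt, Finset.sum_sub_distrib, ← Real.logb_prod _ _ fun t _ =>
      (div_pos (hVt t) (hqt t)).ne', Finset.prod_div_distrib, Finset.sum_const, Finset.card_univ,
      Fintype.card_fin, nsmul_eq_mul, sub_nonpos,
      Real.le_logb_iff_rpow_le one_lt_two (div_pos hVV hQ), le_div_iff₀ hQ] at h3
    rw [Real.rpow_neg two_pos.le, ← div_eq_inv_mul, le_div_iff₀ (by positivity), mul_comm]
    exact h3

/-- The factor `r` cancels between numerator and denominator of `outLaw`, which requires it to be
nonzero; `hi` ensures this. -/
theorem outLaw_eq_of_factor {I Y γ β : Type*} [Fintype I] [Fintype γ] [Fintype β] {p : I → ℝ}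
    {V : I → Y → ℝ} {z : I → γ} (e : γ × β ≃ I) (hz : ∀ c b, z (e (c, b)) = c) {r : γ → ℝ}
    {s : γ → β → ℝ} (hp : ∀ c b, p (e (c, b)) = r c * s c b) (hs : ∀ c, ∑ b, s c b = 1) {i : I}
    (hi : p i ≠ 0) (y : Y) : outLaw p V z (z i) y = ∑ b, s (z i) b * V (e (z i, b)) y := by
  classical
  obtain ⟨⟨c, b⟩, rfl⟩ := e.surjective i
  rw [hp] at hi
  have hr := left_ne_zero_of_mul hi
  rw [hz, outLaw, ← Equiv.sum_comp e, ← Equiv.sum_comp e, Fintype.sum_prod_type,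
    Fintype.sum_prod_type, Fintype.sum_eq_single c, Fintype.sum_eq_single c]
  · simp_rw [hz, hp, if_true, ← Finset.mul_sum, hs, mul_one, mul_assoc, ← Finset.mul_sum]
    rw [mul_div_cancel_left₀ _ hr]
  · intro c' hc
    simp [hz, hc]
  · intro c' hc
    simp [hz, hc]

theorem inputInfo_eq_of_factor {I Y γ β : Type*} [Fintype I] [Fintype Y] [Fintype γ] [Fintype β]
    {p : I → ℝ} {V : I → Y → ℝ} {z : I → γ} (e : γ × β ≃ I) (hz : ∀ c b, z (e (c, b)) = c)
    {r : γ → ℝ} {s : γ → β → ℝ} (hp : ∀ c b, p (e (c, b)) = r c * s c b)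
    (hs : ∀ c, ∑ b, s c b = 1) (q : I → Y → ℝ)
    (hq : ∀ i y, q i y = ∑ b, s (z i) b * V (e (z i, b)) y) :
    inputInfo p V z = ∑ i, p i * ∑ y, V i y * Real.logb 2 (V i y / q i y) := by
  refine Finset.sum_congr rfl fun i _ => ?_
  by_cases hi : p i = 0
  · simp [hi]
  · simp_rw [outLaw_eq_of_factor e hz hp hs hi, hq]

theorem exists_conditional {X₁ X₃ : Type*} [Fintype X₁] [Fintype X₃] {p : X₁ × X₃ → ℝ}
    (hp : p ∈ stdSimplex ℝ (X₁ × X₃)) : ∃ (p₁ : X₁ → ℝ) (p₃ : X₁ → X₃ → ℝ),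
      p₁ ∈ stdSimplex ℝ X₁ ∧ (∀ x₁, p₃ x₁ ∈ stdSimplex ℝ X₃) ∧
        p = fun a => p₁ a.1 * p₃ a.1 a.2 := by
  classical
  have hm : (fun x₁ => ∑ x₃, p (x₁, x₃)) ∈ stdSimplex ℝ X₁ :=
    ⟨fun x₁ => Finset.sum_nonneg fun x₃ _ => hp.1 _, by
      rw [← Fintype.sum_prod_type (f := p)]; exact hp.2⟩
  have hm' : (fun x₃ => ∑ x₁, p (x₁, x₃)) ∈ stdSimplex ℝ X₃ :=
    ⟨fun x₁ => Finset.sum_nonneg fun x₃ _ => hp.1 _, by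
      rw [← Fintype.sum_prod_type_right (f := p)]; exact hp.2⟩
  -- Where the marginal vanishes any law serves as the conditional; the marginal of the second
  -- coordinate is one at hand.
  refine ⟨fun x₁ => ∑ x₃, p (x₁, x₃), fun x₁ => if ∑ x₃, p (x₁, x₃) = 0 then
    fun x₃ => ∑ x₁, p (x₁, x₃) else fun x₃ => p (x₁, x₃) / ∑ x₃, p (x₁, x₃), hm,
    fun x₁ => ?_, ?_⟩
  · beta_reduce
    split_ifs with h
    · exact hm'
    · refine ⟨fun x₃ => div_nonneg (hp.1 _) (hm.1 x₁), ?_⟩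
      rw [← Finset.sum_div, div_self h]
  · funext ⟨x₁, x₃⟩
    simp only
    split_ifs with h
    · rw [h, zero_mul]
      exact (Finset.sum_eq_zero_iff_of_nonneg fun x₃ _ => hp.1 (x₁, x₃)).1 h x₃ (Finset.mem_univ _)
    · rw [mul_div_cancel₀ _ h]

theorem numMessages_le {R : ℝ} (hR : 0 ≤ R) (n : ℕ) :
    (numMessages R n : ℝ) ≤ 2 * (2 : ℝ) ^ (n * R) := by
  have h := Nat.ceil_lt_add_one (a := (2 : ℝ) ^ (n * R)) (by positivity)
  have h1 : (1 : ℝ) ≤ 2 ^ (n * R) := Real.one_le_rpow one_le_two (by positivity)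
  rw [numMessages]
  linarith

theorem numMessages_zero (n : ℕ) : numMessages 0 n = 1 := by
  simp [numMessages]

/-- The alternative `N n = 0` covers zero rates: there are no competing messages, so `T` need not
exceed the rate and may be negative. -/
theorem tendsto_count_mul {N : ℕ → ℝ} {R T K : ℝ} (hN0 : ∀ n, 0 ≤ N n)
    (hN : ∀ n, N n ≤ K * (2 : ℝ) ^ (n * R)) (h : (∀ n, N n = 0) ∨ R < T) :
    Filter.Tendsto (fun n => N n * (2 : ℝ) ^ (-((n : ℝ) * T))) Filter.atTop (nhds 0) := by
  rcases h with h | h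
  · simp [h]
  · have hlim : Filter.Tendsto (fun n : ℕ => K * ((2 : ℝ) ^ (R - T)) ^ n) Filter.atTop
        (nhds 0) := by
      simpa using (tendsto_pow_atTop_nhds_zero_of_lt_one (by positivity)
        (Real.rpow_lt_one_of_one_lt_of_neg one_lt_two (sub_neg.2 h))).const_mul K
    refine squeeze_zero (fun n => mul_nonneg (hN0 n) (by positivity)) (fun n => ?_) hlim
    calc N n * (2 : ℝ) ^ (-((n : ℝ) * T))
        ≤ K * (2 : ℝ) ^ (n * R) * (2 : ℝ) ^ (-((n : ℝ) * T)) :=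
          mul_le_mul_of_nonneg_right (hN n) (by positivity)
      _ = K * ((2 : ℝ) ^ (R - T)) ^ n := by
          rw [mul_assoc, ← Real.rpow_add two_pos, ← Real.rpow_natCast, ← Real.rpow_mul two_pos.le]
          congr 2
          ring

/-! ### Achievability: block codes with time sharing. -/

section

variable {A X₁ X₂ X₃ Y : Type*} [Fintype A] [Fintype X₁] [Fintype X₂] [Fintype X₃] [Fintype Y]

/-- The conditional output laws given, respectively, `(x₁, x₃)`, `(x₁, x₂)`, `x₂`, `x₁` and
nothing, for inputs with the laws `p₂ q` and `p₁ q`, `p₃ q x₁`. -/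
noncomputable def partialLaw (p₁ : A → X₁ → ℝ) (p₂ : A → X₂ → ℝ) (p₃ : A → X₁ → X₃ → ℝ)
    (W : X₁ → X₂ → X₃ → Y → ℝ) : Fin 5 → A × X₁ × X₂ × X₃ → Y → ℝ :=
  ![fun i y => ∑ a, p₂ i.1 a * W i.2.1 a i.2.2.2 y,
    fun i y => ∑ a, p₃ i.1 i.2.1 a * W i.2.1 i.2.2.1 a y,
    fun i y => ∑ a : X₁ × X₃, p₁ i.1 a.1 * p₃ i.1 a.1 a.2 * W a.1 i.2.2.1 a.2 y,
    fun i y => ∑ a : X₂ × X₃, p₂ i.1 a.1 * p₃ i.1 i.2.1 a.2 * W i.2.1 a.1 a.2 y,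
    fun i y => ∑ a : X₂ × X₁ × X₃,
      p₂ i.1 a.1 * (p₁ i.1 a.2.1 * p₃ i.1 a.2.1 a.2.2) * W a.2.1 a.1 a.2.2 y]

open Classical in
/-- Random coding with time sharing: a code whose error probability is at most the probability
that one of the five likelihood ratios fails its threshold `2 ^ (n T s)`, plus the expected
number of wrong messages passing the thresholds. -/
theorem exists_blockCode_le {pQ : A → ℝ} {p₁ : A → X₁ → ℝ} {p₂ : A → X₂ → ℝ}
    {p₃ : A → X₁ → X₃ → ℝ} {W : X₁ → X₂ → X₃ → Y → ℝ} (hQ : pQ ∈ stdSimplex ℝ A)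
    (h₁ : ∀ q, p₁ q ∈ stdSimplex ℝ X₁) (h₂ : ∀ q, p₂ q ∈ stdSimplex ℝ X₂)
    (h₃ : ∀ q x₁, p₃ q x₁ ∈ stdSimplex ℝ X₃)
    (hW : ∀ x₁ x₂ x₃, W x₁ x₂ x₃ ∈ stdSimplex ℝ Y) (n : ℕ) (T : Fin 5 → ℝ) {M₁ M₂ M₃ : ℕ}
    (hM₁ : 0 < M₁) (hM₂ : 0 < M₂) (hM₃ : 0 < M₃) :
    ∃ c : Code X₁ X₂ X₃ Y M₁ M₂ M₃ n, c.avgErrorProb W ≤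
      (∑ s, ∑ i : Fin n → A × X₁ × X₂ × X₃, ∑ y : Fin n → Y,
        (∏ t, inputPmf pQ p₂ (fun q a => p₁ q a.1 * p₃ q a.1 a.2) (i t)) *
          (∏ t, tupleChannel W (i t) (y t)) *
          (if ∏ t, partialLaw p₁ p₂ p₃ W s (i t) (y t) ≤
            (2 : ℝ) ^ (-((n : ℝ) * T s)) * ∏ t, tupleChannel W (i t) (y t) then 0 else 1)) +
      (M₂ - 1) * (2 : ℝ) ^ (-((n : ℝ) * T 0)) + (M₃ - 1) * (2 : ℝ) ^ (-((n : ℝ) * T 1)) +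
      (M₁ - 1) * M₃ * (2 : ℝ) ^ (-((n : ℝ) * T 2)) +
      (M₂ - 1) * (M₃ - 1) * (2 : ℝ) ^ (-((n : ℝ) * T 3)) +
      (M₁ - 1) * (M₂ - 1) * M₃ * (2 : ℝ) ^ (-((n : ℝ) * T 4)) := by
  let Good : (Fin n → A × X₁ × X₂ × X₃) → (Fin n → Y) → Prop := fun i y =>
    ∀ s, ∏ t, partialLaw p₁ p₂ p₃ W s (i t) (y t) ≤
      (2 : ℝ) ^ (-((n : ℝ) * T s)) * ∏ t, tupleChannel W (i t) (y t)
  let P : (Fin n → A) → ℝ := fun q => ∏ t, pQ (q t)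
  have hP : P ∈ stdSimplex ℝ (Fin n → A) :=
    ⟨fun q => Finset.prod_nonneg fun t _ => hQ.1 _, sum_prod_eq_one (μ := fun _ => pQ)
      fun _ => hQ.2⟩
  let bad : (Fin n → A) → ℝ := fun q => ∑ x₂ : Fin n → X₂, (∏ t, p₂ (q t) (x₂ t)) *
    ∑ a : (Fin n → X₁) × (Fin n → X₃),
      (∏ t, p₁ (q t) (a.1 t)) * (∏ t, p₃ (q t) (a.1 t) (a.2 t)) *
      ∑ y : Fin n → Y, (∏ t, W (a.1 t) (x₂ t) (a.2 t) (y t)) *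
        (if ¬ Good (fun t => (q t, a.1 t, x₂ t, a.2 t)) y then 1 else 0)
  have hbad : ∑ q, P q * bad q ≤ ∑ s, ∑ i : Fin n → A × X₁ × X₂ × X₃, ∑ y : Fin n → Y,
        (∏ t, inputPmf pQ p₂ (fun q a => p₁ q a.1 * p₃ q a.1 a.2) (i t)) *
          (∏ t, tupleChannel W (i t) (y t)) *
          (if ∏ t, partialLaw p₁ p₂ p₃ W s (i t) (y t) ≤
            (2 : ℝ) ^ (-((n : ℝ) * T s)) * ∏ t, tupleChannel W (i t) (y t) then 0 else 1) := by
    have heq : ∑ q, P q * bad q = ∑ i : Fin n → A × X₁ × X₂ × X₃, ∑ y : Fin n → Y,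
        (∏ t, inputPmf pQ p₂ (fun q a => p₁ q a.1 * p₃ q a.1 a.2) (i t)) *
          (∏ t, tupleChannel W (i t) (y t)) * (if ¬ Good i y then 1 else 0) := by
      simp_rw [sum_arrow_prod (α := A), sum_arrow_prod (α := X₁), sum_arrow_prod (α := X₂)]
      refine Finset.sum_congr rfl fun q _ => ?_
      simp only [P, bad, inputPmf, tupleChannel, Finset.prod_mul_distrib, Finset.mul_sum,
        Fintype.sum_prod_type]
      rw [Finset.sum_comm]
      refine Finset.sum_congr rfl fun x₁ _ => Finset.sum_congr rfl fun x₂ _ =>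
        Finset.sum_congr rfl fun x₃ _ => Finset.sum_congr rfl fun y _ => ?_
      ring
    rw [heq, Finset.sum_comm (γ := Fin 5)]
    refine Finset.sum_le_sum fun i _ => ?_
    rw [Finset.sum_comm (γ := Fin 5)]
    refine Finset.sum_le_sum fun y _ => ?_
    rw [← Finset.mul_sum]
    refine mul_le_mul_of_nonneg_left ?_ (mul_nonneg (Finset.prod_nonneg fun t _ =>
      mul_nonneg (mul_nonneg (hQ.1 _) ((h₂ _).1 _)) (mul_nonneg ((h₁ _).1 _) ((h₃ _ _).1 _)))
      (Finset.prod_nonneg fun t _ => (hW _ _ _).1 _))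
    have h0 : ∀ s ∈ (Finset.univ : Finset (Fin 5)), (0 : ℝ) ≤
        if ∏ t, partialLaw p₁ p₂ p₃ W s (i t) (y t) ≤
        (2 : ℝ) ^ (-((n : ℝ) * T s)) * ∏ t, tupleChannel W (i t) (y t) then 0 else 1 := by
      intro s _
      split_ifs <;> norm_num
    by_cases hg : Good i y
    · rw [if_neg (not_not.2 hg)]
      exact Finset.sum_nonneg h0
    · rw [if_pos hg]
      simp only [Good, not_forall] at hg
      obtain ⟨s, hs⟩ := hg
      refine le_trans (le_of_eq ?_) (Finset.single_le_sum h0 (Finset.mem_univ s))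
      rw [if_neg hs]
  -- Only the rejection probability depends on `q` in the bound, so one good sequence can be fixed
  -- and known to all terminals; the single-shot bound is then applied to the alphabets of
  -- `n`-letter words.
  obtain ⟨q, hq⟩ := exists_le_of_sum_le hP hbad
  obtain ⟨f₁, f₂, f₃, h, herr⟩ := exists_code_avgErrorProb_le
    (p₁ := fun x : Fin n → X₁ => ∏ t, p₁ (q t) (x t))
    (p₂ := fun x : Fin n → X₂ => ∏ t, p₂ (q t) (x t))
    (p₃ := fun (x₁ : Fin n → X₁) (x : Fin n → X₃) => ∏ t, p₃ (q t) (x₁ t) (x t))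
    (W := fun (x₁ : Fin n → X₁) (x₂ : Fin n → X₂) (x₃ : Fin n → X₃) (y : Fin n → Y) =>
      ∏ t, W (x₁ t) (x₂ t) (x₃ t) (y t))
    (G := fun x₁ x₂ x₃ y => Good (fun t => (q t, x₁ t, x₂ t, x₃ t)) y)
    ⟨fun _ => Finset.prod_nonneg fun t _ => (h₁ _).1 _, sum_prod_eq_one fun t => (h₁ (q t)).2⟩
    ⟨fun _ => Finset.prod_nonneg fun t _ => (h₂ _).1 _, sum_prod_eq_one fun t => (h₂ (q t)).2⟩
    (fun x₁ => ⟨fun _ => Finset.prod_nonneg fun t _ => (h₃ _ _).1 _,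
      sum_prod_eq_one fun t => (h₃ (q t) (x₁ t)).2⟩)
    (fun x₁ x₂ x₃ => ⟨fun _ => Finset.prod_nonneg fun t _ => (hW _ _ _).1 _,
      sum_prod_eq_one fun t => (hW (x₁ t) (x₂ t) (x₃ t)).2⟩)
    (ε₂ := (2 : ℝ) ^ (-((n : ℝ) * T 0))) (ε₃ := (2 : ℝ) ^ (-((n : ℝ) * T 1)))
    (ε₁₃ := (2 : ℝ) ^ (-((n : ℝ) * T 2))) (ε₂₃ := (2 : ℝ) ^ (-((n : ℝ) * T 3)))
    (ε₁₂₃ := (2 : ℝ) ^ (-((n : ℝ) * T 4)))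
    (by positivity) (by positivity) (by positivity) (by positivity) (by positivity)
    (fun x₁ x₂ x₃ y hG => by
      refine le_trans (le_of_eq ?_) (hG 0)
      simp_rw [← Finset.prod_mul_distrib]
      exact sum_pi_prod (fun t a => p₂ (q t) a * W (x₁ t) a (x₃ t) (y t)))
    (fun x₁ x₂ x₃ y hG => by
      refine le_trans (le_of_eq ?_) (hG 1)
      simp_rw [← Finset.prod_mul_distrib]
      exact sum_pi_prod (fun t a => p₃ (q t) (x₁ t) a * W (x₁ t) (x₂ t) a (y t)))
    (fun x₁ x₂ x₃ y hG => by
      refine le_trans (le_of_eq ?_) (hG 2)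
      simp_rw [← Finset.prod_mul_distrib]
      rw [Fintype.sum_prod_type, ← sum_arrow_prod (fun f : Fin n → X₁ × X₃ =>
        ∏ t, p₁ (q t) (f t).1 * p₃ (q t) (f t).1 (f t).2 * W (f t).1 (x₂ t) (f t).2 (y t))]
      exact sum_pi_prod (fun t (a : X₁ × X₃) =>
        p₁ (q t) a.1 * p₃ (q t) a.1 a.2 * W a.1 (x₂ t) a.2 (y t)))
    (fun x₁ x₂ x₃ y hG => by
      refine le_trans (le_of_eq ?_) (hG 3)
      simp_rw [← Finset.prod_mul_distrib]
      rw [Fintype.sum_prod_type, ← sum_arrow_prod (fun f : Fin n → X₂ × X₃ =>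
        ∏ t, p₂ (q t) (f t).1 * p₃ (q t) (x₁ t) (f t).2 * W (x₁ t) (f t).1 (f t).2 (y t))]
      exact sum_pi_prod (fun t (a : X₂ × X₃) =>
        p₂ (q t) a.1 * p₃ (q t) (x₁ t) a.2 * W (x₁ t) a.1 a.2 (y t)))
    (fun x₁ x₂ x₃ y hG => by
      refine le_trans (le_of_eq ?_) (hG 4)
      simp_rw [← Finset.prod_mul_distrib]
      have e := sum_pi_prod (fun t (a : X₂ × X₁ × X₃) => p₂ (q t) a.1 *
        (p₁ (q t) a.2.1 * p₃ (q t) a.2.1 a.2.2) * W a.2.1 a.1 a.2.2 (y t))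
      simp_rw [sum_arrow_prod (α := X₂), sum_arrow_prod (α := X₁)] at e
      simp_rw [Fintype.sum_prod_type (α₁ := Fin n → X₂), Fintype.sum_prod_type (α₁ := Fin n → X₁)]
      exact e) hM₁ hM₂ hM₃
  refine ⟨⟨f₁, f₂, f₃, h⟩, ?_⟩
  have herr' : (Code.mk f₁ f₂ f₃ h).avgErrorProb W ≤ bad q +
      (M₂ - 1) * (2 : ℝ) ^ (-((n : ℝ) * T 0)) + (M₃ - 1) * (2 : ℝ) ^ (-((n : ℝ) * T 1)) +
      (M₁ - 1) * M₃ * (2 : ℝ) ^ (-((n : ℝ) * T 2)) +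
      (M₂ - 1) * (M₃ - 1) * (2 : ℝ) ^ (-((n : ℝ) * T 3)) +
      (M₁ - 1) * (M₂ - 1) * M₃ * (2 : ℝ) ^ (-((n : ℝ) * T 4)) := by
    unfold Code.avgErrorProb Code.errorProb
    simp only [bad]
    convert herr
  linarith

end

section

variable {A X₁ X₂ X₃ Y : Type*} [Fintype X₁] [Fintype X₂] [Fintype X₃] [Fintype Y]
  {pQ : A → ℝ} {p₁ : A → X₁ → ℝ} {p₂ : A → X₂ → ℝ} {p₃ : A → X₁ → X₃ → ℝ}
  {W : X₁ → X₂ → X₃ → Y → ℝ}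

theorem inputPmf_mem [Fintype A] {p₁₃ : A → X₁ × X₃ → ℝ} (hQ : pQ ∈ stdSimplex ℝ A)
    (h₂ : ∀ q, p₂ q ∈ stdSimplex ℝ X₂) (h₁₃ : ∀ q, p₁₃ q ∈ stdSimplex ℝ (X₁ × X₃)) :
    inputPmf pQ p₂ p₁₃ ∈ stdSimplex ℝ (A × X₁ × X₂ × X₃) := by
  refine ⟨fun i => mul_nonneg (mul_nonneg (hQ.1 _) ((h₂ _).1 _)) ((h₁₃ _).1 _), ?_⟩
  have h := fun q => (h₁₃ q).2
  simp_rw [Fintype.sum_prod_type] at h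
  simp only [inputPmf, Fintype.sum_prod_type, mul_assoc, ← Finset.mul_sum]
  rw [← hQ.2]
  refine Finset.sum_congr rfl fun q _ => ?_
  rw [Finset.sum_comm]
  simp_rw [← Finset.mul_sum, h, mul_one, (h₂ q).2, mul_one]

/-- The log-likelihood ratios of the threshold decoder have the mutual informations as means. -/
theorem inputInfo_eq_partialLaw [Fintype A] (h₁ : ∀ q, p₁ q ∈ stdSimplex ℝ X₁)
    (h₂ : ∀ q, p₂ q ∈ stdSimplex ℝ X₂) (h₃ : ∀ q x₁, p₃ q x₁ ∈ stdSimplex ℝ X₃) :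
    let p := inputPmf pQ p₂ (fun q a => p₁ q a.1 * p₃ q a.1 a.2)
    let J : Fin 5 → ℝ := fun s => ∑ i, p i * ∑ y, tupleChannel W i y *
      Real.logb 2 (tupleChannel W i y / partialLaw p₁ p₂ p₃ W s i y)
    inputInfo p (tupleChannel W) (fun i => (i.2.1, i.2.2.2, i.1)) = J 0 ∧
    inputInfo p (tupleChannel W) (fun i => (i.2.1, i.2.2.1, i.1)) = J 1 ∧
    inputInfo p (tupleChannel W) (fun i => (i.2.2.1, i.1)) = J 2 ∧
    inputInfo p (tupleChannel W) (fun i => (i.2.1, i.1)) = J 3 ∧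
    inputInfo p (tupleChannel W) (fun i => i.1) = J 4 := by
  intro p J
  have h₁₃ := fun q => mul_mem_stdSimplex (h₁ q) (h₃ q)
  refine ⟨?_, ?_, ?_, ?_, ?_⟩
  -- In each case `e` separates the conditioning symbols from the averaged ones, and `r`, `s` are
  -- the corresponding factors of the input law.
  · exact inputInfo_eq_of_factor
      (e := ⟨fun t => (t.1.2.2, t.1.1, t.2, t.1.2.1), fun i => ((i.2.1, i.2.2.2, i.1), i.2.2.1),
        fun _ => rfl, fun _ => rfl⟩) (fun _ _ => rfl)
      (r := fun c => pQ c.2.2 * (p₁ c.2.2 c.1 * p₃ c.2.2 c.1 c.2.1)) (s := fun c => p₂ c.2.2)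
      (fun c b => by simp only [p, inputPmf, Equiv.coe_fn_mk]; ring) (fun c => (h₂ _).2) _
      (fun i y => rfl)
  · exact inputInfo_eq_of_factor
      (e := ⟨fun t => (t.1.2.2, t.1.1, t.1.2.1, t.2), fun i => ((i.2.1, i.2.2.1, i.1), i.2.2.2),
        fun _ => rfl, fun _ => rfl⟩) (fun _ _ => rfl)
      (r := fun c => pQ c.2.2 * p₂ c.2.2 c.2.1 * p₁ c.2.2 c.1) (s := fun c => p₃ c.2.2 c.1)
      (fun c b => by simp only [p, inputPmf, Equiv.coe_fn_mk]; ring) (fun c => (h₃ _ _).2) _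
      (fun i y => rfl)
  · exact inputInfo_eq_of_factor
      (e := ⟨fun t => (t.1.2, t.2.1, t.1.1, t.2.2), fun i => ((i.2.2.1, i.1), i.2.1, i.2.2.2),
        fun _ => rfl, fun _ => rfl⟩) (fun _ _ => rfl)
      (r := fun c => pQ c.2 * p₂ c.2 c.1) (s := fun c a => p₁ c.2 a.1 * p₃ c.2 a.1 a.2)
      (fun c b => by simp only [p, inputPmf, Equiv.coe_fn_mk]) (fun c => (h₁₃ _).2) _
      (fun i y => rfl)
  · exact inputInfo_eq_of_factor
      (e := ⟨fun t => (t.1.2, t.1.1, t.2.1, t.2.2), fun i => ((i.2.1, i.1), i.2.2.1, i.2.2.2),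
        fun _ => rfl, fun _ => rfl⟩) (fun _ _ => rfl)
      (r := fun c => pQ c.2 * p₁ c.2 c.1) (s := fun c a => p₂ c.2 a.1 * p₃ c.2 c.1 a.2)
      (fun c b => by simp only [p, inputPmf, Equiv.coe_fn_mk]; ring)
      (fun c => (mul_mem_stdSimplex (h₂ _) fun _ => h₃ _ _).2) _ (fun i y => rfl)
  · exact inputInfo_eq_of_factor
      (e := ⟨fun t => (t.1, t.2.2.1, t.2.1, t.2.2.2), fun i => (i.1, i.2.2.1, i.2.1, i.2.2.2),
        fun _ => rfl, fun _ => rfl⟩) (fun _ _ => rfl)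
      (r := fun c => pQ c) (s := fun c a => p₂ c a.1 * (p₁ c a.2.1 * p₃ c a.2.1 a.2.2))
      (fun c b => by simp only [p, inputPmf, Equiv.coe_fn_mk]; ring)
      (fun c => (mul_mem_stdSimplex (h₂ _) fun _ => h₁₃ _).2) _ (fun i y => rfl)

theorem partialLaw_pos (h₁ : ∀ q, p₁ q ∈ stdSimplex ℝ X₁)
    (h₂ : ∀ q, p₂ q ∈ stdSimplex ℝ X₂) (h₃ : ∀ q x₁, p₃ q x₁ ∈ stdSimplex ℝ X₃)
    (hW : ∀ x₁ x₂ x₃, W x₁ x₂ x₃ ∈ stdSimplex ℝ Y) (s : Fin 5) (i : A × X₁ × X₂ × X₃) (y : Y)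
    (hi : 0 < inputPmf pQ p₂ (fun q a => p₁ q a.1 * p₃ q a.1 a.2) i)
    (hy : 0 < tupleChannel W i y) : 0 < partialLaw p₁ p₂ p₃ W s i y := by
  obtain ⟨q, x₁, x₂, x₃⟩ := i
  simp only [inputPmf] at hi
  have e₂ : 0 < p₂ q x₂ := lt_of_le_of_ne ((h₂ _).1 _) fun h => by simp [← h] at hi
  have e₁ : 0 < p₁ q x₁ := lt_of_le_of_ne ((h₁ _).1 _) fun h => by simp [← h] at hi
  have e₃ : 0 < p₃ q x₁ x₃ := lt_of_le_of_ne ((h₃ _ _).1 _) fun h => by simp [← h] at hi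
  have hy : 0 < W x₁ x₂ x₃ y := hy
  have n₁ := fun q => (h₁ q).1
  have n₂ := fun q => (h₂ q).1
  have n₃ := fun q x => (h₃ q x).1
  have nW := fun a b c => (hW a b c).1
  fin_cases s
  · exact Finset.sum_pos' (fun a _ => mul_nonneg (n₂ _ _) (nW _ _ _ _))
      ⟨x₂, Finset.mem_univ _, mul_pos e₂ hy⟩
  · exact Finset.sum_pos' (fun a _ => mul_nonneg (n₃ _ _ _) (nW _ _ _ _))
      ⟨x₃, Finset.mem_univ _, mul_pos e₃ hy⟩
  · exact Finset.sum_pos' (fun a _ => mul_nonneg (mul_nonneg (n₁ _ _) (n₃ _ _ _)) (nW _ _ _ _))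
      ⟨(x₁, x₃), Finset.mem_univ _, mul_pos (mul_pos e₁ e₃) hy⟩
  · exact Finset.sum_pos' (fun a _ => mul_nonneg (mul_nonneg (n₂ _ _) (n₃ _ _ _)) (nW _ _ _ _))
      ⟨(x₂, x₃), Finset.mem_univ _, mul_pos (mul_pos e₂ e₃) hy⟩
  · exact Finset.sum_pos' (fun a _ => mul_nonneg (mul_nonneg (n₂ _ _)
      (mul_nonneg (n₁ _ _) (n₃ _ _ _))) (nW _ _ _ _))
      ⟨(x₂, x₁, x₃), Finset.mem_univ _, mul_pos (mul_pos e₂ (mul_pos e₁ e₃)) hy⟩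

end

/-- The threshold must always lie below the information, for concentration, and above the rate
whenever there is room; otherwise `J - 1` is an arbitrary choice, used only when that sum of rates
is zero. -/
theorem exists_between_rate (r J : ℝ) : ∃ T < J, r < J → r < T := by
  by_cases h : r < J
  · obtain ⟨T, h1, h2⟩ := exists_between h
    exact ⟨T, h2, fun _ => h1⟩
  · exact ⟨J - 1, by linarith, fun h' => absurd h' h⟩

theorem achievable_of_lt {k : ℕ} {X₁ X₂ X₃ Y : Type*} [Fintype X₁] [Fintype X₂]
    [Fintype X₃] [Fintype Y] {pQ : Fin k → ℝ} {p₁ : Fin k → X₁ → ℝ} {p₂ : Fin k → X₂ → ℝ}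
    {p₃ : Fin k → X₁ → X₃ → ℝ} {W : X₁ → X₂ → X₃ → Y → ℝ} (hQ : pQ ∈ stdSimplex ℝ (Fin k))
    (h₁ : ∀ q, p₁ q ∈ stdSimplex ℝ X₁) (h₂ : ∀ q, p₂ q ∈ stdSimplex ℝ X₂)
    (h₃ : ∀ q x₁, p₃ q x₁ ∈ stdSimplex ℝ X₃) (hW : ∀ x₁ x₂ x₃, W x₁ x₂ x₃ ∈ stdSimplex ℝ Y)
    {J : Fin 5 → ℝ}
    (hJ : ∀ s, J s = ∑ i, inputPmf pQ p₂ (fun q a => p₁ q a.1 * p₃ q a.1 a.2) i *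
      ∑ y, tupleChannel W i y *
        Real.logb 2 (tupleChannel W i y / partialLaw p₁ p₂ p₃ W s i y))
    {R₁ R₂ R₃ : ℝ} (hR₁ : 0 ≤ R₁) (hR₂ : 0 ≤ R₂) (hR₃ : 0 ≤ R₃)
    (hJ₂ : R₂ = 0 ∨ R₂ < J 0) (hJ₃ : R₃ = 0 ∨ R₃ < J 1)
    (hJ₁₃ : R₁ + R₃ = 0 ∨ R₁ + R₃ < J 2) (hJ₂₃ : R₂ + R₃ = 0 ∨ R₂ + R₃ < J 3)
    (hJ₁₂₃ : R₁ + R₂ + R₃ = 0 ∨ R₁ + R₂ + R₃ < J 4) : Achievable W R₁ R₂ R₃ := by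
  classical
  have h₁₃ := fun q => mul_mem_stdSimplex (h₁ q) (h₃ q)
  let r : Fin 5 → ℝ := ![R₂, R₃, R₁ + R₃, R₂ + R₃, R₁ + R₂ + R₃]
  choose T hT hrT using fun s => exists_between_rate (r s) (J s)
  choose ρ hρ0 hρ1 hρ using fun s => exists_threshold_bound (inputPmf_mem hQ h₂ h₁₃)
    (V := tupleChannel W) (q := partialLaw p₁ p₂ p₃ W s) (fun i => hW _ _ _)
    (partialLaw_pos h₁ h₂ h₃ hW s) (T := T s) ((hT s).trans_eq (hJ s))
  have c₁ := fun n => (Nat.one_le_cast (α := ℝ)).2 (numMessages_pos R₁ n)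
  have c₂ := fun n => (Nat.one_le_cast (α := ℝ)).2 (numMessages_pos R₂ n)
  have c₃ := fun n => (Nat.one_le_cast (α := ℝ)).2 (numMessages_pos R₃ n)
  have b₁ := numMessages_le hR₁
  have b₂ := numMessages_le hR₂
  have b₃ := numMessages_le hR₃
  have d₁ : ∀ n, 0 ≤ (numMessages R₁ n : ℝ) - 1 := fun n => sub_nonneg.2 (c₁ n)
  have d₂ : ∀ n, 0 ≤ (numMessages R₂ n : ℝ) - 1 := fun n => sub_nonneg.2 (c₂ n)
  have d₃ : ∀ n, 0 ≤ (numMessages R₃ n : ℝ) - 1 := fun n => sub_nonneg.2 (c₃ n)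
  have g₁ : ∀ n, (numMessages R₁ n : ℝ) - 1 ≤ 2 * (2 : ℝ) ^ (n * R₁) := fun n => by linarith [b₁ n]
  have g₂ : ∀ n, (numMessages R₂ n : ℝ) - 1 ≤ 2 * (2 : ℝ) ^ (n * R₂) := fun n => by linarith [b₂ n]
  have g₃ : ∀ n, (numMessages R₃ n : ℝ) - 1 ≤ 2 * (2 : ℝ) ^ (n * R₃) := fun n => by linarith [b₃ n]
  have z₁ : R₁ = 0 → ∀ n, (numMessages R₁ n : ℝ) - 1 = 0 := by
    rintro rfl n
    simp [numMessages_zero]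
  have z₂ : R₂ = 0 → ∀ n, (numMessages R₂ n : ℝ) - 1 = 0 := by
    rintro rfl n
    simp [numMessages_zero]
  have z₃ : R₃ = 0 → ∀ n, (numMessages R₃ n : ℝ) - 1 = 0 := by
    rintro rfl n
    simp [numMessages_zero]
  have hpow : ∀ (n : ℕ) (a b : ℝ), (2 : ℝ) ^ (n * (a + b)) = 2 ^ (n * a) * 2 ^ (n * b) := by
    intro n a b
    rw [mul_add, Real.rpow_add two_pos]
  have l₀ := tendsto_count_mul (N := fun n => (numMessages R₂ n : ℝ) - 1) (T := T 0) d₂ g₂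
    (hJ₂.imp z₂ (hrT 0))
  have l₁ := tendsto_count_mul (N := fun n => (numMessages R₃ n : ℝ) - 1) (T := T 1) d₃ g₃
    (hJ₃.imp z₃ (hrT 1))
  -- The constants `4` and `8` collect a factor `2` per message set from `numMessages_le`.
  have l₂ := tendsto_count_mul (N := fun n => ((numMessages R₁ n : ℝ) - 1) * numMessages R₃ n)
    (R := R₁ + R₃) (K := 4) (T := T 2)
    (fun n => mul_nonneg (d₁ n) (Nat.cast_nonneg _))
    (fun n => (mul_le_mul (g₁ n) (b₃ n) (Nat.cast_nonneg _) (by positivity)).trans_eq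
      (by rw [hpow]; ring))
    (hJ₁₃.imp (fun h n => by rw [z₁ (by linarith) n, zero_mul]) (hrT 2))
  have l₃ := tendsto_count_mul
    (N := fun n => ((numMessages R₂ n : ℝ) - 1) * (numMessages R₃ n - 1))
    (R := R₂ + R₃) (K := 4) (T := T 3)
    (fun n => mul_nonneg (d₂ n) (d₃ n))
    (fun n => (mul_le_mul (g₂ n) (g₃ n) (d₃ n) (by positivity)).trans_eq
      (by rw [hpow]; ring))
    (hJ₂₃.imp (fun h n => by rw [z₂ (by linarith) n, zero_mul]) (hrT 3))
  have l₄ := tendsto_count_mul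
    (N := fun n => ((numMessages R₁ n : ℝ) - 1) * (numMessages R₂ n - 1) * numMessages R₃ n)
    (R := R₁ + R₂ + R₃) (K := 8) (T := T 4)
    (fun n => mul_nonneg (mul_nonneg (d₁ n) (d₂ n)) (Nat.cast_nonneg _))
    (fun n => (mul_le_mul (mul_le_mul (g₁ n) (g₂ n) (d₂ n) (by positivity)) (b₃ n)
      (Nat.cast_nonneg _) (by positivity)).trans_eq (by rw [hpow, hpow]; ring))
    (hJ₁₂₃.imp (fun h n => by rw [z₁ (by linarith) n, zero_mul, zero_mul]) (hrT 4))
  have lρ : Filter.Tendsto (fun n : ℕ => ∑ s, ρ s ^ n) Filter.atTop (nhds 0) := by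
    simpa using tendsto_finsetSum (Finset.univ : Finset (Fin 5)) fun s _ =>
      tendsto_pow_atTop_nhds_zero_of_lt_one (hρ0 s) (hρ1 s)
  have lim := ((((lρ.add l₀).add l₁).add l₂).add l₃).add l₄
  simp only [add_zero] at lim
  choose c hc using fun n : ℕ => exists_blockCode_le hQ h₁ h₂ h₃ hW n T
    (numMessages_pos R₁ n) (numMessages_pos R₂ n) (numMessages_pos R₃ n)
  refine ⟨hR₁, hR₂, hR₃, c, squeeze_zero (fun n => (c n).avgErrorProb_nonneg hW) (fun n => ?_) lim⟩
  refine (hc n).trans ?_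
  gcongr with s _
  exact hρ s n

theorem rateRegion_subset_capacityRegion {X₁ X₂ X₃ Y : Type*} [Fintype X₁] [Fintype X₂]
    [Fintype X₃] [Fintype Y] {W : X₁ → X₂ → X₃ → Y → ℝ}
    (hW : ∀ x₁ x₂ x₃, W x₁ x₂ x₃ ∈ stdSimplex ℝ Y) : rateRegion W ⊆ capacityRegion W := by
  rintro ⟨R₁, R₂, R₃⟩ ⟨hR₁, hR₂, hR₃, k, pQ, p₂, p₁₃, hQ, h₂, h₁₃, hB⟩
  choose p₁ p₃ h₁ h₃ hp using fun q => exists_conditional (h₁₃ q)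
  obtain rfl : p₁₃ = fun q a => p₁ q a.1 * p₃ q a.1 a.2 := funext hp
  rw [rateBounds_iff hW] at hB
  obtain ⟨e₀, e₁, e₂, e₃, e₄⟩ := inputInfo_eq_partialLaw (pQ := pQ) (W := W) h₁ h₂ h₃
  rw [e₀, e₁, e₂, e₃, e₄] at hB
  obtain ⟨i₀, i₁, i₂, i₃, i₄⟩ := hB
  simp only at hR₁ hR₂ hR₃ i₀ i₁ i₂ i₃ i₄
  -- Scaling by `1 - 1 / (n + 1)` makes every bound with a positive left side strict and keeps zero
  -- sums zero, so informations equal to `0` need no separate argument.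
  have hlim : ∀ R : ℝ, Filter.Tendsto (fun n : ℕ => (1 - 1 / ((n : ℝ) + 1)) * R) Filter.atTop
      (nhds R) := by
    intro R
    simpa using ((tendsto_const_nhds (x := (1 : ℝ))).sub
      tendsto_one_div_add_atTop_nhds_zero_nat).mul_const R
  refine mem_closure_of_tendsto
    ((hlim R₁).prodMk_nhds ((hlim R₂).prodMk_nhds (hlim R₃))) (Filter.Eventually.of_forall ?_)
  intro n
  have hd : (0 : ℝ) < 1 / ((n : ℝ) + 1) := by positivity
  have hd' : (0 : ℝ) ≤ 1 - 1 / ((n : ℝ) + 1) := by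
    rw [sub_nonneg, div_le_one (by positivity)]
    linarith [Nat.cast_nonneg (α := ℝ) n]
  have scale : ∀ {R I : ℝ}, 0 ≤ R → R ≤ I →
      (1 - 1 / ((n : ℝ) + 1)) * R = 0 ∨ (1 - 1 / ((n : ℝ) + 1)) * R < I := by
    intro R I hR hRI
    rcases hR.eq_or_lt with rfl | hR
    · simp
    · right
      nlinarith
  refine achievable_of_lt hQ h₁ h₂ h₃ hW (fun s => rfl) (mul_nonneg hd' hR₁)
    (mul_nonneg hd' hR₂) (mul_nonneg hd' hR₃) (scale hR₂ i₀) (scale hR₃ i₁) ?_ ?_ ?_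
  · rw [← mul_add]
    exact scale (add_nonneg hR₁ hR₃) i₂
  · rw [← mul_add]
    exact scale (add_nonneg hR₂ hR₃) i₃
  · rw [← mul_add, ← mul_add]
    exact scale (add_nonneg (add_nonneg hR₁ hR₂) hR₃) i₄

end CogRelayMAC

theorem proposition2 {X₁ X₂ X₃ Y : Type*} [Fintype X₁] [Fintype X₂] [Fintype X₃] [Fintype Y]
    (W : X₁ → X₂ → X₃ → Y → ℝ) (hW : ∀ x₁ x₂ x₃, W x₁ x₂ x₃ ∈ stdSimplex ℝ Y) :
    CogRelayMAC.capacityRegion W =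
      closure {R : ℝ × ℝ × ℝ | 0 ≤ R.1 ∧ 0 ≤ R.2.1 ∧ 0 ≤ R.2.2 ∧
        ∃ (k : ℕ) (pQ : Fin k → ℝ) (p₂ : Fin k → X₂ → ℝ) (p₁₃ : Fin k → X₁ × X₃ → ℝ),
          pQ ∈ stdSimplex ℝ (Fin k) ∧
          (∀ q, p₂ q ∈ stdSimplex ℝ X₂) ∧
          (∀ q, p₁₃ q ∈ stdSimplex ℝ (X₁ × X₃)) ∧
          CogRelayMAC.RateBounds (CogRelayMAC.jointPmf pQ p₂ p₁₃ W) R.1 R.2.1 R.2.2} :=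
  Set.Subset.antisymm
    (closure_minimal (fun _ hR => CogRelayMAC.Achievable.mem_closure_rateRegion hW hR)
      isClosed_closure)
    (closure_minimal (CogRelayMAC.rateRegion_subset_capacityRegion hW) isClosed_closure)
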